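/- Let $k$ be a field of characteristic $\neq 2$ and let $f \in k[x_1,x_2,x_3,x_4]$ be a homogeneous cubic polynomial such that the surface $V = \{f=0\} \subset \mathbf{P}^3_k$ is smooth over $k$. Let $L/k$ be a finite extension, let $e_1,e_2,e_3,e_4$ be a basis of $L^{\oplus 4}$, and put $S = L e_3 + L e_4$. Suppose that the line $\ell = \mathbf{P}(S) \subset \mathbf{P}^3_L$ is contained in $V_L = V \otimes_k L$ (for instance, $\ell$ is a line on $V$ with field of definition $L$). Let $T = \operatorname{ann}(S) \subset (L^{\oplus 4})^\vee$ be the space of linear forms vanishing on $\ell$. The projection from $\ell$ extends to a morphism $V_L \to \mathbf{P}(T^\vee) \cong \mathbf{P}^1_L$ (whose fibres are the residual conics of $\ell$ in the planes containing $\ell$); let $\pi \colon \ell \to \mathbf{P}(T^\vee)$ be its restriction to $\ell$, which is unique. There is exactly one nontrivial automorphism $i \colon \ell \to \ell$ over $L$ with $\pi \circ i = \pi$, the involution associated to $\ell$. Write $\langle a\rangle \in \operatorname{GW}(L)$ for the class of the form $(x,y) \mapsto axy$ in the Grothendieck–Witt ring, and let $\deg^{\mathbf{A}^1}(i) \in \operatorname{GW}(L)$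 be the $\mathbf{A}^1$-degree of $i$ after any identification $\ell \cong \mathbf{P}^1_L$ given by a basis of $S$. Here the $\mathbf{A}^1$-degree of a morphism $\mathbf{P}^1_L \to \mathbf{P}^1_L$, $z \mapsto F(z)/G(z)$, of degree $n$ is the class of its Bézout form, the symmetric bilinear form on $L^n$ with Gram matrix $(c_{pq})_{0 \le p,q<n}$ where $\frac{F(X)G(Y)-F(Y)G(X)}{X-Y} = \sum c_{pq} X^pY^q$; thus $z \mapsto (\alpha z+\beta)/(\gamma z+\delta)$ has degree $\langle \alpha\delta-\beta\gamma\rangle$. Then the resultant $\operatorname{Res}\left(\frac{\partial f}{\partial e_1}\big|_S, \frac{\partial f}{\partial e_2}\big|_S\right) \in L$ of the two binary quadratic forms obtained by restricting the directional derivatives of $f$ to $S$ (written in the coordinates on $S$ dual to $e_3,e_4$) is nonzero, and $$\langle -1\rangle \cdot \deg^{\mathbf{A}^1}(i) = \left\langle \operatorname{Res}\left(\frac{\partial f}{\partial e_1}\Big|_S, \frac{\partial f}{\partial e_2}\Big|_S\right)\right\rangle \quad \text{in } \operatorname{GW}(L).$$ -/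

import Mathlib

open scoped TensorProduct
universe u v

/-- A finite-dimensional vector space with a nondegenerate symmetric bilinear form. -/
structure SymBilinSpace (K : Type u) [Field K] where
  carrier : Type u
  [addCommGroup : AddCommGroup carrier]
  [module : Module K carrier]
  [finite : FiniteDimensional K carrier]
  form : LinearMap.BilinForm K carrier
  symm : ∀ x y, form x y = form y x
  nondeg : ∀ x, (∀ y, form x y = 0) → x = 0

namespace SymBilinSpace

attribute [instance] SymBilinSpace.addCommGroup SymBilinSpace.module SymBilinSpace.finite

variable {K : Type u} [Field K]

/-- Isometry of symmetric bilinear spaces. -/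
def Isometric (A B : SymBilinSpace K) : Prop :=
  ∃ e : A.carrier ≃ₗ[K] B.carrier, ∀ x y, B.form (e x) (e y) = A.form x y

instance isometrySetoid (K : Type u) [Field K] : Setoid (SymBilinSpace K) where
  r := Isometric
  iseqv :=
    { refl := fun A => ⟨LinearEquiv.refl K A.carrier, fun _ _ => rfl⟩
      symm := fun {A B} ⟨e, he⟩ => ⟨e.symm, fun x y => by rw [← he]; simp⟩
      trans := fun {A B C} ⟨e, he⟩ ⟨e', he'⟩ => ⟨e.trans e', fun x y => by simp [he, he']⟩ }

/-- The zero space. -/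
def zeroSpace (K : Type u) [Field K] : SymBilinSpace K where
  carrier := PUnit
  form := 0
  symm := fun _ _ => rfl
  nondeg := fun _ _ => rfl

/-- The rank one space `⟨a⟩`: the form `(x, y) ↦ a x y` on `K`. -/
def rankOne (a : Kˣ) : SymBilinSpace K where
  carrier := K
  form := (a : K) • LinearMap.mul K K
  symm := fun x y => by simp [mul_comm x y]
  nondeg := fun x h => by simpa using h 1

/-- Orthogonal direct sum. -/
def orthSum (A B : SymBilinSpace K) : SymBilinSpace K where
  carrier := A.carrier × B.carrier
  form := A.form.compl₁₂ (LinearMap.fst K _ _) (LinearMap.fst K _ _) +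
    B.form.compl₁₂ (LinearMap.snd K _ _) (LinearMap.snd K _ _)
  symm := fun x y => by simp [A.symm x.1, B.symm x.2]
  nondeg := fun x h => by
    refine Prod.ext (A.nondeg _ fun y => ?_) (B.nondeg _ fun y => ?_)
    · simpa using h (y, 0)
    · simpa using h (0, y)

theorem tensor_nondeg (A B : SymBilinSpace K) (x : A.carrier ⊗[K] B.carrier)
    (h : ∀ y, LinearMap.BilinForm.tmul A.form B.form x y = 0) : x = 0 := by
  have hA : Function.Injective A.form := (injective_iff_map_eq_zero _).2 fun x hx =>
    A.nondeg x fun y => by rw [hx]; rfl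
  have hB : Function.Injective B.form := (injective_iff_map_eq_zero _).2 fun x hx =>
    B.nondeg x fun y => by rw [hx]; rfl
  have h2 : Function.Injective (TensorProduct.dualDistribEquiv K A.carrier B.carrier) :=
    LinearEquiv.injective _
  have h1 : Function.Injective (TensorProduct.map A.form B.form) :=
    TensorProduct.map_injective_of_flat_flat _ _ hA hB
  apply h1
  apply h2
  rw [map_zero, map_zero]
  have key : ((TensorProduct.dualDistribEquiv K A.carrier B.carrier).toLinearMap ∘ₗ
      TensorProduct.map A.form B.form) = LinearMap.BilinForm.tmul A.form B.form := by
    ext a b c d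
    simp [TensorProduct.dualDistribEquiv, TensorProduct.dualDistribEquivOfBasis, mul_comm]
  have := LinearMap.congr_fun key x
  simp only [LinearMap.comp_apply, LinearEquiv.coe_coe] at this
  rw [this]
  ext a b
  exact h (a ⊗ₜ b)

/-- Tensor product of spaces: `(x ⊗ y, x' ⊗ y') ↦ A(x, x') B(y, y')`. -/
def tensor (A B : SymBilinSpace K) : SymBilinSpace K where
  carrier := A.carrier ⊗[K] B.carrier
  form := LinearMap.BilinForm.tmul A.form B.form
  symm := fun x y => (LinearMap.IsSymm.tmul ⟨A.symm⟩ ⟨B.symm⟩).eq x y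
  nondeg := tensor_nondeg A B

theorem orthSum_congr {A A' B B' : SymBilinSpace K} (h : Isometric A A') (h' : Isometric B B') :
    Isometric (orthSum A B) (orthSum A' B') := by
  obtain ⟨e, he⟩ := h
  obtain ⟨e', he'⟩ := h'
  exact ⟨e.prodCongr e', fun x y => congrArg₂ (· + ·) (he x.1 y.1) (he' x.2 y.2)⟩

/-- An isometry can be checked on pure tensors. -/
theorem tensor_isometric {A B C : SymBilinSpace K} (e : A.carrier ⊗[K] B.carrier ≃ₗ[K] C.carrier)
    (he : ∀ a b c d, C.form (e (a ⊗ₜ b)) (e (c ⊗ₜ d)) = A.form a c * B.form b d) :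
    Isometric (tensor A B) C := by
  refine ⟨e, fun x y => ?_⟩
  have : C.form.compl₁₂ e.toLinearMap e.toLinearMap = (tensor A B).form := by
    apply TensorProduct.ext'
    intro a b
    apply TensorProduct.ext'
    intro c d
    exact (he a b c d).trans (mul_comm _ _)
  exact LinearMap.congr_fun₂ this x y

theorem tensor_congr {A A' B B' : SymBilinSpace K} (h : Isometric A A') (h' : Isometric B B') :
    Isometric (tensor A B) (tensor A' B') := by
  obtain ⟨e, he⟩ := h
  obtain ⟨e', he'⟩ := h'
  refine tensor_isometric (TensorProduct.congr e e') fun a b c d => ?_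
  exact (congrArg₂ (· * ·) (he' b d) (he a c)).trans (mul_comm _ _)

theorem tensor_assoc (A B C : SymBilinSpace K) :
    Isometric (tensor (tensor A B) C) (tensor A (tensor B C)) := by
  refine ⟨TensorProduct.assoc K A.carrier B.carrier C.carrier, fun x y => ?_⟩
  have : (tensor A (tensor B C)).form.compl₁₂
      (TensorProduct.assoc K A.carrier B.carrier C.carrier).toLinearMap
      (TensorProduct.assoc K A.carrier B.carrier C.carrier).toLinearMap =
      (tensor (tensor A B) C).form := by
    apply TensorProduct.ext_threefold
    intro a b c
    apply TensorProduct.ext_threefold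
    intro a' b' c'
    exact mul_assoc (C.form c c') (B.form b b') (A.form a a')
  exact LinearMap.congr_fun₂ this x y

/-- Isometry classes of nondegenerate symmetric bilinear spaces. -/
def IsoClass (K : Type u) [Field K] : Type (u + 1) := Quotient (isometrySetoid K)

/-- The isometry class of a space. -/
def isoClass (A : SymBilinSpace K) : IsoClass K := Quotient.mk (isometrySetoid K) A

instance (K : Type u) [Field K] : Zero (IsoClass K) where
  zero := isoClass (zeroSpace K)

instance (K : Type u) [Field K] : One (IsoClass K) where
  one := isoClass (rankOne 1)

instance (K : Type u) [Field K] : Add (IsoClass K) where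
  add := Quotient.map₂ orthSum fun _ _ h _ _ h' => orthSum_congr h h'

instance (K : Type u) [Field K] : Mul (IsoClass K) where
  mul := Quotient.map₂ tensor fun _ _ h _ _ h' => tensor_congr h h'

/-- Isometry classes form a commutative semiring under orthogonal sum and tensor product. -/
instance (K : Type u) [Field K] : CommSemiring (IsoClass K) where
  nsmul := nsmulRec
  npow := npowRec
  add_assoc := by
    rintro ⟨A⟩ ⟨B⟩ ⟨C⟩
    exact Quotient.sound ⟨LinearEquiv.prodAssoc K A.carrier B.carrier C.carrier,
      fun x y => (add_assoc _ _ _).symm⟩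
  add_comm := by
    rintro ⟨A⟩ ⟨B⟩
    exact Quotient.sound ⟨LinearEquiv.prodComm K A.carrier B.carrier,
      fun x y => add_comm _ _⟩
  zero_add := by
    rintro ⟨A⟩
    exact Quotient.sound ⟨LinearEquiv.uniqueProd (R := K) (M := A.carrier) (M₂ := PUnit.{u + 1}),
      fun x y => (zero_add _).symm⟩
  add_zero := by
    rintro ⟨A⟩
    exact Quotient.sound ⟨LinearEquiv.prodUnique (R := K) (M := A.carrier) (M₂ := PUnit.{u + 1}),
      fun x y => (add_zero _).symm⟩
  mul_assoc := by
    rintro ⟨A⟩ ⟨B⟩ ⟨C⟩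
    exact Quotient.sound (tensor_assoc A B C)
  mul_comm := by
    rintro ⟨A⟩ ⟨B⟩
    exact Quotient.sound (tensor_isometric (TensorProduct.comm K A.carrier B.carrier)
      fun a b c d => rfl)
  one_mul := by
    rintro ⟨A⟩
    exact Quotient.sound (tensor_isometric (A := rankOne 1) (TensorProduct.lid K A.carrier)
      fun (a : K) b (c : K) d => by
        change A.form (a • b) (c • d) = ((1 : Kˣ) : K) * (a * c) * A.form b d
        simp; ring)
  mul_one := by
    rintro ⟨A⟩
    exact Quotient.sound (tensor_isometric (B := rankOne 1) (TensorProduct.rid K A.carrier)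
      fun a (b : K) c (d : K) => by
        change A.form (b • a) (d • c) = A.form a c * (((1 : Kˣ) : K) * (b * d))
        simp; ring)
  left_distrib := by
    rintro ⟨A⟩ ⟨B⟩ ⟨C⟩
    exact Quotient.sound (tensor_isometric (B := orthSum B C) (C := orthSum (tensor A B) (tensor A C))
      (TensorProduct.prodRight K K A.carrier B.carrier C.carrier)
      fun a b c d => by
        change B.form b.1 d.1 * A.form a c + C.form b.2 d.2 * A.form a c =
          A.form a c * (B.form b.1 d.1 + C.form b.2 d.2)
        ring)
  right_distrib := by
    rintro ⟨A⟩ ⟨B⟩ ⟨C⟩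
    exact Quotient.sound (tensor_isometric (A := orthSum A B) (C := orthSum (tensor A C) (tensor B C))
      (TensorProduct.prodLeft K K A.carrier B.carrier C.carrier)
      fun a b c d => by
        change C.form b d * A.form a.1 c.1 + C.form b d * B.form a.2 c.2 =
          (A.form a.1 c.1 + B.form a.2 c.2) * C.form b d
        ring)
  zero_mul := by
    rintro ⟨A⟩
    have : Subsingleton (PUnit.{u + 1} ⊗[K] A.carrier) := inferInstance
    exact Quotient.sound (tensor_isometric (A := zeroSpace K) (C := zeroSpace K)
      (0 : (PUnit.{u + 1} ⊗[K] A.carrier) ≃ₗ[K] PUnit.{u + 1}) fun a b c d => (zero_mul _).symm)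
  mul_zero := by
    rintro ⟨A⟩
    have : Subsingleton (A.carrier ⊗[K] PUnit.{u + 1}) := inferInstance
    exact Quotient.sound (tensor_isometric (B := zeroSpace K) (C := zeroSpace K)
      (0 : (A.carrier ⊗[K] PUnit.{u + 1}) ≃ₗ[K] PUnit.{u + 1}) fun a b c d => (mul_zero _).symm)

end SymBilinSpace

/-- The Grothendieck-Witt group of `K`: the Grothendieck group of the monoid of isometry classes of
nondegenerate symmetric bilinear spaces under orthogonal sum. -/
def GW (K : Type u) [Field K] : Type (u + 1) :=
  Algebra.GrothendieckAddGroup (SymBilinSpace.IsoClass K)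

namespace GW

variable {K : Type u} [Field K]

noncomputable instance (K : Type u) [Field K] : AddCommGroup (GW K) :=
  inferInstanceAs (AddCommGroup (Algebra.GrothendieckAddGroup (SymBilinSpace.IsoClass K)))

/-- The canonical map from isometry classes to the Grothendieck-Witt group. -/
noncomputable def of : SymBilinSpace.IsoClass K →+ GW K :=
  Algebra.GrothendieckAddGroup.of

/-- The universal property of the Grothendieck group. -/
noncomputable def lift {G : Type v} [AddCommGroup G] (f : SymBilinSpace.IsoClass K →+ G) :
    GW K →+ G :=
  Algebra.GrothendieckAddGroup.lift f

@[simp] theorem lift_of {G : Type v} [AddCommGroup G] (f : SymBilinSpace.IsoClass K →+ G)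
    (x : SymBilinSpace.IsoClass K) : lift f (of x) = f x :=
  DFunLike.congr_fun (Algebra.GrothendieckAddGroup.lift.symm_apply_apply f) x

theorem hom_ext {G : Type v} [AddCommGroup G] {f g : GW K →+ G}
    (h : ∀ x, f (of x) = g (of x)) : f = g :=
  Algebra.GrothendieckAddGroup.lift.symm.injective (AddMonoidHom.ext h)

/-- The class of a symmetric bilinear space. -/
noncomputable def cls (A : SymBilinSpace K) : GW K :=
  of A.isoClass

/-- The class `⟨a⟩` of the form `(x, y) ↦ a x y` on `K`. -/
noncomputable def unitCls (a : Kˣ) : GW K := cls (SymBilinSpace.rankOne a)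

/-- Multiplication on `GW K`: the biadditive extension of the tensor product of spaces. -/
noncomputable def mulHom (K : Type u) [Field K] : GW K →+ GW K →+ GW K :=
  lift
    { toFun := fun A => lift (of.comp (AddMonoidHom.mulLeft A))
      map_zero' := hom_ext fun B => by simp
      map_add' := fun A B => hom_ext fun C => by simp [add_mul] }

noncomputable instance (K : Type u) [Field K] : Mul (GW K) where
  mul x y := mulHom K x y

noncomputable instance (K : Type u) [Field K] : One (GW K) where
  one := of 1

theorem mul_def (x y : GW K) : x * y = mulHom K x y := rfl

theorem one_def : (1 : GW K) = of 1 := rfl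

@[simp] theorem mulHom_of (x y : SymBilinSpace.IsoClass K) :
    mulHom K (of x) (of y) = of (x * y) := by
  simp [mulHom]

/-- The Grothendieck-Witt ring. -/
noncomputable instance (K : Type u) [Field K] : CommRing (GW K) where
  __ := (inferInstance : AddCommGroup (GW K))
  __ := (inferInstance : Mul (GW K))
  __ := (inferInstance : One (GW K))
  left_distrib := fun x y z => map_add (mulHom K x) y z
  right_distrib := fun x y z => by simp [mul_def]
  zero_mul := fun x => by simp [mul_def]
  mul_zero := fun x => by simp [mul_def]
  mul_comm := fun x y => by
    have : mulHom K = (mulHom K).flip := hom_ext fun a => hom_ext fun b => by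
      simp [mul_comm]
    exact DFunLike.congr_fun (DFunLike.congr_fun this x) y
  one_mul := fun x => by
    have : mulHom K (of 1) = AddMonoidHom.id _ := hom_ext fun a => by simp
    exact DFunLike.congr_fun this x
  mul_one := fun x => by
    have : (mulHom K).flip (of 1) = AddMonoidHom.id _ := hom_ext fun a => by simp
    exact DFunLike.congr_fun this x
  mul_assoc := fun x y z => by
    have h : ((mulHom K).flip z).comp ((mulHom K).flip y) = (mulHom K).flip (mulHom K y z) :=
      hom_ext fun a => by
        have h' : ((mulHom K).flip z).comp (mulHom K (of a)) =
            (mulHom K (of a)).comp ((mulHom K).flip z) :=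
          hom_ext fun b => by
            have h'' : mulHom K (mulHom K (of a) (of b)) =
                (mulHom K (of a)).comp (mulHom K (of b)) :=
              hom_ext fun c => by simp [mul_assoc]
            exact DFunLike.congr_fun h'' z
        exact DFunLike.congr_fun h' y
    exact DFunLike.congr_fun h x

end GW

/-- A pair of binary forms of the same degree without a common zero over an algebraic closure:
homogeneous coordinates of a morphism `ℙ¹ → ℙ¹` over `K`. -/
structure FormPair (K : Type u) [Field K] where
  deg : ℕ
  form : Fin 2 → MvPolynomial (Fin 2) K
  homog : ∀ i, (form i).IsHomogeneous deg
  basePointFree : ∀ v : Fin 2 → AlgebraicClosure K, v ≠ 0 →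
    ∃ i, MvPolynomial.aeval v (form i) ≠ 0

namespace FormPair

variable {K : Type u} [Field K]

/-- Two pairs define the same morphism exactly when they are proportional. -/
instance setoid (K : Type u) [Field K] : Setoid (FormPair K) where
  r F G := ∃ c : Kˣ, ∀ i, G.form i = MvPolynomial.C (c : K) * F.form i
  iseqv :=
    { refl := fun F => ⟨1, fun i => by simp⟩
      symm := fun {F G} ⟨c, hc⟩ => ⟨c⁻¹, fun i => by
        rw [hc, ← mul_assoc, ← map_mul, Units.inv_mul, map_one, one_mul]⟩
      trans := fun {F G H} ⟨c, hc⟩ ⟨d, hd⟩ => ⟨d * c, fun i => by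
        rw [hd, hc, ← mul_assoc, ← map_mul, Units.val_mul]⟩ }

theorem exists_form_ne_zero (F : FormPair K) : ∃ i, F.form i ≠ 0 := by
  obtain ⟨i, hi⟩ := F.basePointFree (fun _ => 1) fun h => one_ne_zero (congrFun h 0)
  exact ⟨i, fun h => hi (by rw [h, map_zero])⟩

theorem deg_eq_of_equiv {F G : FormPair K} (h : F ≈ G) : F.deg = G.deg := by
  obtain ⟨c, hc⟩ := h
  obtain ⟨i, hi⟩ := F.exists_form_ne_zero
  have h1 : (G.form i).IsHomogeneous F.deg := by
    rw [hc]
    simpa using (MvPolynomial.isHomogeneous_C (Fin 2) (c : K)).mul (F.homog i)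
  refine h1.inj_right (G.homog i) ?_
  rw [hc]
  exact mul_ne_zero (by simp) hi

/-- The identity morphism. -/
noncomputable def id (K : Type u) [Field K] : FormPair K where
  deg := 1
  form := MvPolynomial.X
  homog := fun i => MvPolynomial.isHomogeneous_X K i
  basePointFree := fun v hv => by
    by_contra! h
    exact hv (funext fun i => by simpa using h i)

/-- Composition of morphisms: substitution of forms. -/
noncomputable def comp (F G : FormPair K) : FormPair K where
  deg := G.deg * F.deg
  form := fun i => MvPolynomial.aeval G.form (F.form i)
  homog := fun i => (F.homog i).aeval G.form G.homog
  basePointFree := fun v hv => by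
    obtain ⟨j, hj⟩ := G.basePointFree v hv
    obtain ⟨i, hi⟩ := F.basePointFree (fun j => MvPolynomial.aeval v (G.form j))
      fun h => hj (congrFun h j)
    refine ⟨i, fun h => hi ?_⟩
    rw [← h]
    exact (MvPolynomial.comp_aeval_apply G.form (MvPolynomial.aeval v) (F.form i)).symm

theorem aeval_smul {p : MvPolynomial (Fin 2) K} {n : ℕ} (hp : p.IsHomogeneous n) (c : K)
    (g : Fin 2 → MvPolynomial (Fin 2) K) :
    MvPolynomial.aeval (fun i => MvPolynomial.C c * g i) p =
      MvPolynomial.C (c ^ n) * MvPolynomial.aeval g p := by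
  rw [MvPolynomial.aeval_def, MvPolynomial.aeval_def, MvPolynomial.eval₂_eq',
    MvPolynomial.eval₂_eq', Finset.mul_sum]
  refine Finset.sum_congr rfl fun m hm => ?_
  have hd : ∑ i, m i = n := by
    have := hp (MvPolynomial.mem_support_iff.1 hm)
    rw [Finsupp.weight_apply, Finsupp.sum_fintype _ _ (by simp)] at this
    simpa using this
  simp only [mul_pow, Finset.prod_mul_distrib]
  rw [Finset.prod_pow_eq_pow_sum, hd, map_pow]
  ring

end FormPair

/-- Morphisms `ℙ¹ → ℙ¹` over `K`. -/
def P1Map (K : Type u) [Field K] : Type u := Quotient (FormPair.setoid K)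

/-- Endomorphisms of `ℙ¹` form a monoid under composition, `φ * ψ = φ ∘ ψ`. -/
noncomputable instance (K : Type u) [Field K] : Monoid (P1Map K) where
  one := Quotient.mk (FormPair.setoid K) (FormPair.id K)
  mul := Quotient.map₂ FormPair.comp fun F F' ⟨c, hc⟩ G G' ⟨d, hd⟩ =>
    ⟨c * d ^ F.deg, fun i => by
      have h : G'.form = fun i => MvPolynomial.C (d : K) * G.form i := funext hd
      change MvPolynomial.aeval G'.form (F'.form i) = _ * MvPolynomial.aeval G.form (F.form i)
      rw [h, hc, map_mul, FormPair.aeval_smul (F.homog i)]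
      simp [MvPolynomial.algebraMap_eq, mul_assoc]⟩
  mul_assoc := by
    rintro ⟨F⟩ ⟨G⟩ ⟨H⟩
    refine Quotient.sound ⟨1, fun i => ?_⟩
    change MvPolynomial.aeval (fun j => MvPolynomial.aeval H.form (G.form j)) (F.form i) =
      _ * MvPolynomial.aeval H.form (MvPolynomial.aeval G.form (F.form i))
    rw [MvPolynomial.comp_aeval_apply, Units.val_one, map_one, one_mul]
  one_mul := by
    rintro ⟨F⟩
    refine Quotient.sound ⟨1, fun i => ?_⟩
    change F.form i = _ * MvPolynomial.aeval F.form (MvPolynomial.X i)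
    simp
  mul_one := by
    rintro ⟨F⟩
    refine Quotient.sound ⟨1, fun i => ?_⟩
    change F.form i = _ * MvPolynomial.aeval MvPolynomial.X (F.form i)
    simp

/-- Dehomogenization `p(X, 1)` of a binary form. -/
noncomputable def dehom {K : Type u} [Field K] (p : MvPolynomial (Fin 2) K) : Polynomial K :=
  MvPolynomial.aeval ![Polynomial.X, 1] p

namespace Bezout

variable {K : Type u} [Field K]

/-- The coefficients `c p q` of
`(a(X) b(Y) - a(Y) b(X)) / (X - Y) = ∑ c p q X ^ p Y ^ q`. -/
def coeff (a b : Polynomial K) (p q : ℕ) : K :=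
  ∑ k ∈ Finset.range (p + 1),
    (a.coeff (p + q + 1 - k) * b.coeff k - a.coeff k * b.coeff (p + q + 1 - k))

theorem coeff_comm_of_le (a b : Polynomial K) {p q : ℕ} (h : p ≤ q) :
    coeff a b p q = coeff a b q p := by
  unfold coeff
  rw [add_comm q p, Finset.sum_sub_distrib, Finset.sum_sub_distrib,
    ← Finset.sum_range_add_sum_Ico (fun k => a.coeff (p + q + 1 - k) * b.coeff k)
      (show p + 1 ≤ q + 1 by omega),
    ← Finset.sum_range_add_sum_Ico (fun k => a.coeff k * b.coeff (p + q + 1 - k))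
      (show p + 1 ≤ q + 1 by omega)]
  have : ∑ k ∈ Finset.Ico (p + 1) (q + 1), a.coeff (p + q + 1 - k) * b.coeff k =
      ∑ k ∈ Finset.Ico (p + 1) (q + 1), a.coeff k * b.coeff (p + q + 1 - k) := by
    refine Finset.sum_nbij' (fun k => p + q + 1 - k) (fun k => p + q + 1 - k) ?_ ?_ ?_ ?_ ?_
    · intro k hk; rw [Finset.mem_Ico] at *; omega
    · intro k hk; rw [Finset.mem_Ico] at *; omega
    · intro k hk; rw [Finset.mem_Ico] at *; omega
    · intro k hk; rw [Finset.mem_Ico] at *; omega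
    · intro k hk
      rw [Finset.mem_Ico] at hk
      rw [show p + q + 1 - (p + q + 1 - k) = k by omega]
  rw [this]
  ring

theorem coeff_comm (a b : Polynomial K) (p q : ℕ) : coeff a b p q = coeff a b q p := by
  rcases le_total p q with h | h
  · exact coeff_comm_of_le a b h
  · exact (coeff_comm_of_le a b h).symm

theorem coeff_swap (a b : Polynomial K) (p q : ℕ) : coeff b a p q = -coeff a b p q := by
  unfold coeff
  rw [← Finset.sum_neg_distrib]
  exact Finset.sum_congr rfl fun k _ => by ring

theorem coeff_eq_zero {a b : Polynomial K} {n : ℕ} (ha : a.natDegree ≤ n) (hb : b.natDegree ≤ n)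
    {p q : ℕ} (hp : n ≤ p) : coeff a b p q = 0 := by
  rw [coeff_comm]
  refine Finset.sum_eq_zero fun k hk => ?_
  rw [Finset.mem_range] at hk
  rw [Polynomial.coeff_eq_zero_of_natDegree_lt (p := a) (n := q + p + 1 - k) (by omega),
    Polynomial.coeff_eq_zero_of_natDegree_lt (p := b) (n := q + p + 1 - k) (by omega)]
  ring

theorem coeff_divX_iterate (a : Polynomial K) (q m : ℕ) :
    (Polynomial.divX^[q] a).coeff m = a.coeff (m + q) := by
  induction q generalizing m with
  | zero => rfl
  | succ q ih =>
    rw [Function.iterate_succ_apply', Polynomial.coeff_divX, ih]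
    congr 1; omega

theorem coeff_column (a b : Polynomial K) (p q : ℕ) :
    (b * Polynomial.divX^[q + 1] a - a * Polynomial.divX^[q + 1] b).coeff p = coeff a b p q := by
  rw [Polynomial.coeff_sub, Polynomial.coeff_mul, Polynomial.coeff_mul,
    Finset.Nat.sum_antidiagonal_eq_sum_range_succ_mk,
    Finset.Nat.sum_antidiagonal_eq_sum_range_succ_mk, ← Finset.sum_sub_distrib]
  refine Finset.sum_congr rfl fun k hk => ?_
  rw [Finset.mem_range] at hk
  simp only [coeff_divX_iterate]
  rw [show p - k + (q + 1) = p + q + 1 - k by omega]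
  ring

theorem eq_zero_of_lead {a b : Polynomial K} {n : ℕ} (ha : a.natDegree = n) (hb : b.natDegree ≤ n)
    (hab : IsCoprime a b) (v : Fin n → K)
    (h : ∀ p : Fin n, ∑ q : Fin n, coeff a b p q * v q = 0) : v = 0 := by
  by_cases ha0 : a = 0
  · subst ha0
    simp only [Polynomial.natDegree_zero] at ha
    subst ha
    exact Subsingleton.elim _ _
  set H : Polynomial K := ∑ q : Fin n, Polynomial.C (v q) * Polynomial.divX^[(q : ℕ) + 1] a with hH
  set G : Polynomial K := ∑ q : Fin n, Polynomial.C (v q) * Polynomial.divX^[(q : ℕ) + 1] b with hG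
  have key : b * H - a * G = 0 := by
    have e : b * H - a * G = ∑ q : Fin n, Polynomial.C (v q) *
        (b * Polynomial.divX^[(q : ℕ) + 1] a - a * Polynomial.divX^[(q : ℕ) + 1] b) := by
      rw [hH, hG, Finset.mul_sum, Finset.mul_sum, ← Finset.sum_sub_distrib]
      exact Finset.sum_congr rfl fun q _ => by ring
    ext p
    rw [e, Polynomial.finsetSum_coeff, Polynomial.coeff_zero]
    simp only [Polynomial.coeff_C_mul, coeff_column]
    by_cases hp : p < n
    · rw [← h ⟨p, hp⟩]
      exact Finset.sum_congr rfl fun q _ => mul_comm _ _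
    · exact Finset.sum_eq_zero fun q _ => by
        rw [coeff_eq_zero ha.le hb (not_lt.1 hp), mul_zero]
  have hHc : ∀ m, H.coeff m = ∑ q : Fin n, v q * a.coeff (m + (q + 1)) := fun m => by
    simp [hH, Polynomial.finsetSum_coeff, coeff_divX_iterate, add_assoc]
  have hdvd : a ∣ H := by
    refine hab.dvd_of_dvd_mul_left ⟨G, ?_⟩
    linear_combination key
  have hH0 : H = 0 := by
    by_contra hne
    have hle := Polynomial.natDegree_le_of_dvd hdvd hne
    apply hne
    refine Polynomial.leadingCoeff_eq_zero.1 ?_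
    rw [Polynomial.leadingCoeff, hHc]
    exact Finset.sum_eq_zero fun q _ => by
      rw [Polynomial.coeff_eq_zero_of_natDegree_lt (by omega), mul_zero]
  have hv : ∀ j : ℕ, ∀ hj : j < n, v ⟨j, hj⟩ = 0 := by
    intro j
    induction j using Nat.strong_induction_on with
    | _ j ih =>
      intro hj
      have h1 : ∑ q : Fin n, v q * a.coeff ((n - 1 - j) + (q + 1)) = 0 := by
        rw [← hHc, hH0, Polynomial.coeff_zero]
      rw [Finset.sum_eq_single (⟨j, hj⟩ : Fin n)] at h1
      · rw [show n - 1 - j + ((⟨j, hj⟩ : Fin n) + 1 : ℕ) = n by simp only; omega] at h1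
        refine (mul_eq_zero.1 h1).resolve_right ?_
        rw [← ha]
        exact Polynomial.leadingCoeff_ne_zero.2 ha0
      · rintro ⟨q, hq⟩ - hne
        rcases lt_trichotomy q j with hlt | heq | hgt
        · rw [ih q hlt hq, zero_mul]
        · exact absurd (Fin.ext heq) hne
        · rw [Polynomial.coeff_eq_zero_of_natDegree_lt (by simp only; omega), mul_zero]
      · intro hmem; exact absurd (Finset.mem_univ _) hmem
  exact funext fun q => hv q q.2

/-- The Bézout form of degree `n` of a coprime pair `a`, `b` with `max (deg a) (deg b) = n`. -/
noncomputable def space (n : ℕ) (a b : Polynomial K)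
    (h : a.natDegree ≤ n ∧ b.natDegree ≤ n ∧ (a.natDegree = n ∨ b.natDegree = n) ∧
      IsCoprime a b) : SymBilinSpace K where
  carrier := Fin n → K
  form := Matrix.toBilin' (Matrix.of fun p q : Fin n => coeff a b p q)
  symm := fun x y => by
    rw [Matrix.toBilin'_apply, Matrix.toBilin'_apply, Finset.sum_comm]
    refine Finset.sum_congr rfl fun p _ => Finset.sum_congr rfl fun q _ => ?_
    simp only [Matrix.of_apply]
    rw [coeff_comm]
    ring
  nondeg := fun x hx => by
    have h0 : ∀ p : Fin n, ∑ q : Fin n, coeff a b p q * x q = 0 := fun p => by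
      have := hx (Pi.single p 1)
      rw [Matrix.toBilin'_apply] at this
      rw [← this]
      refine Finset.sum_congr rfl fun q _ => ?_
      rw [Finset.sum_eq_single p]
      · simp only [Matrix.of_apply, Pi.single_eq_same, mul_one]
        rw [coeff_comm, mul_comm]
      · intro r _ hr; simp [Pi.single_eq_of_ne hr]
      · intro hmem; exact absurd (Finset.mem_univ _) hmem
    obtain ⟨ha, hb, hn | hn, hc⟩ := h
    · exact eq_zero_of_lead hn hb hc x h0
    · refine eq_zero_of_lead hn ha hc.symm x fun p => ?_
      simp only [coeff_swap a b, neg_mul, Finset.sum_neg_distrib, h0 p, neg_zero]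

theorem space_isometric {n m : ℕ} {a b a' b' : Polynomial K} (h h') (hnm : n = m) (c : Kˣ)
    (ha : a' = Polynomial.C (c : K) * a) (hb : b' = Polynomial.C (c : K) * b) :
    SymBilinSpace.Isometric (space n a b h) (space m a' b' h') := by
  subst hnm ha hb
  have hc : ∀ p q, coeff (Polynomial.C (c : K) * a) (Polynomial.C (c : K) * b) p q =
      (c : K) ^ 2 * coeff a b p q := fun p q => by
    simp only [coeff, Polynomial.coeff_C_mul, Finset.mul_sum]
    exact Finset.sum_congr rfl fun k _ => by ring
  refine ⟨LinearEquiv.smulOfUnit c⁻¹, fun (x y : Fin n → K) => ?_⟩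
  change Matrix.toBilin' _ (c⁻¹ • x) (c⁻¹ • y) = Matrix.toBilin' _ x y
  rw [Matrix.toBilin'_apply, Matrix.toBilin'_apply]
  refine Finset.sum_congr rfl fun p _ => Finset.sum_congr rfl fun q _ => ?_
  simp only [Matrix.of_apply, hc, Pi.smul_apply, Units.smul_def, smul_eq_mul, Units.val_inv_eq_inv_val]
  have := c.ne_zero
  field_simp

end Bezout

namespace FormPair

variable {K : Type u} [Field K]

theorem aeval_dehom {A : Type v} [CommRing A] [Algebra K A] (p : MvPolynomial (Fin 2) K) (z : A) :
    Polynomial.aeval z (dehom p) = MvPolynomial.aeval ![z, 1] p := by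
  rw [dehom, MvPolynomial.comp_aeval_apply]
  congr 2
  funext i
  fin_cases i <;> simp

theorem dehom_eq_sum (p : MvPolynomial (Fin 2) K) :
    dehom p = ∑ m ∈ p.support, Polynomial.C (p.coeff m) * Polynomial.X ^ (m 0) := by
  rw [dehom, MvPolynomial.aeval_def, MvPolynomial.eval₂_eq']
  simp [Fin.prod_univ_two]

theorem exponents_add {p : MvPolynomial (Fin 2) K} {n : ℕ} (hp : p.IsHomogeneous n)
    {m : Fin 2 →₀ ℕ} (hm : m ∈ p.support) : m 0 + m 1 = n := by
  have := hp (MvPolynomial.mem_support_iff.1 hm)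
  rw [Finsupp.weight_apply, Finsupp.sum_fintype _ _ (by simp)] at this
  simpa using this

theorem natDegree_dehom_le {p : MvPolynomial (Fin 2) K} {n : ℕ} (hp : p.IsHomogeneous n) :
    (dehom p).natDegree ≤ n := by
  rw [dehom_eq_sum]
  refine Polynomial.natDegree_sum_le_of_forall_le _ _ fun m hm => ?_
  have := exponents_add hp hm
  exact (Polynomial.natDegree_C_mul_X_pow_le _ _).trans (by omega)

theorem coeff_dehom {p : MvPolynomial (Fin 2) K} {n : ℕ} (hp : p.IsHomogeneous n)
    {A : Type v} [CommRing A] [Algebra K A] :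
    MvPolynomial.aeval (![1, 0] : Fin 2 → A) p = algebraMap K A ((dehom p).coeff n) := by
  rw [dehom_eq_sum, Polynomial.finsetSum_coeff, map_sum, MvPolynomial.aeval_def,
    MvPolynomial.eval₂_eq']
  refine Finset.sum_congr rfl fun m hm => ?_
  have := exponents_add hp hm
  by_cases h1 : m 1 = 0
  · simp [Fin.prod_univ_two, h1, show n = m 0 by omega]
  · have : n ≠ m 0 := by omega
    simp [Fin.prod_univ_two, h1, Polynomial.coeff_X_pow, this]

theorem bezout_conditions (F : FormPair K) :
    (dehom (F.form 0)).natDegree ≤ F.deg ∧ (dehom (F.form 1)).natDegree ≤ F.deg ∧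
      ((dehom (F.form 0)).natDegree = F.deg ∨ (dehom (F.form 1)).natDegree = F.deg) ∧
      IsCoprime (dehom (F.form 0)) (dehom (F.form 1)) := by
  refine ⟨natDegree_dehom_le (F.homog 0), natDegree_dehom_le (F.homog 1), ?_, ?_⟩
  · obtain ⟨i, hi⟩ := F.basePointFree ![1, 0] fun h => one_ne_zero (congrFun h 0)
    rw [coeff_dehom (F.homog i), map_ne_zero_iff _ (algebraMap K _).injective] at hi
    have := le_antisymm (natDegree_dehom_le (F.homog i)) (Polynomial.le_natDegree_of_ne_zero hi)
    fin_cases i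
    · exact Or.inl this
    · exact Or.inr this
  · rw [Polynomial.isCoprime_iff_aeval_ne_zero_of_isAlgClosed K (AlgebraicClosure K)]
    intro z
    obtain ⟨i, hi⟩ := F.basePointFree ![z, 1] fun h => one_ne_zero (congrFun h 1)
    rw [← aeval_dehom] at hi
    fin_cases i
    · exact Or.inl hi
    · exact Or.inr hi

/-- The Bézout form of a morphism given by a pair of forms. -/
noncomputable def bezoutSpace (F : FormPair K) : SymBilinSpace K :=
  Bezout.space F.deg (dehom (F.form 0)) (dehom (F.form 1)) F.bezout_conditions

end FormPair

/-- The `𝔸¹`-degree in `GW K` of a morphism `ℙ¹ → ℙ¹` of degree `n`: the class of its Bézout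
form, with Gram matrix `c p q`, `0 ≤ p, q < n`, where
`(F(X) G(Y) - F(Y) G(X)) / (X - Y) = ∑ c p q X ^ p Y ^ q` if the morphism is `z ↦ F(z) / G(z)`.
For `z ↦ (α z + β) / (γ z + δ)` it is `⟨α δ - β γ⟩`. -/
noncomputable def P1Map.a1Degree {K : Type u} [Field K] : P1Map K → GW K :=
  Quotient.lift (fun F => GW.cls F.bezoutSpace) fun F G hFG => by
    obtain ⟨c, hc⟩ := id hFG
    refine congrArg GW.of (Quotient.sound ?_)
    refine Bezout.space_isometric _ _ (FormPair.deg_eq_of_equiv hFG) c ?_ ?_ <;>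
    · rw [hc]
      simp [dehom]

section CubicSurface

variable {k : Type v} [Field k] {L : Type u} [Field L]

/-- The surface `f = 0` in `ℙ³` is smooth over `k` (Jacobian criterion at all geometric points). -/
def IsSmoothSurface (f : MvPolynomial (Fin 4) k) : Prop :=
  ∀ v : Fin 4 → AlgebraicClosure k, v ≠ 0 → MvPolynomial.aeval v f = 0 →
    ∃ j, MvPolynomial.aeval v (MvPolynomial.pderiv j f) ≠ 0

/-- The linear polynomial of a linear functional on `L⁴`. -/
noncomputable def linearPoly (φ : Module.Dual L (Fin 4 → L)) : MvPolynomial (Fin 4) L :=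
  ∑ j, MvPolynomial.C (φ (Pi.single j 1)) * MvPolynomial.X j

/-- The homogeneous ideal of the linear subspace `ℙ(S)` of `ℙ³`. -/
noncomputable def lineIdeal (S : Submodule L (Fin 4 → L)) : Ideal (MvPolynomial (Fin 4) L) :=
  Ideal.span (linearPoly '' (S.dualAnnihilator : Set (Module.Dual L (Fin 4 → L))))

/-- The restriction of a polynomial to the plane spanned by `w 0`, `w 1`, in the coordinates dual
to these vectors: `p(x w₀ + y w₁)`. -/
noncomputable def restrictTo (w : Fin 2 → Fin 4 → L) (p : MvPolynomial (Fin 4) L) :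
    MvPolynomial (Fin 2) L :=
  MvPolynomial.aeval (fun j => ∑ m, MvPolynomial.C (w m j) * MvPolynomial.X m) p

/-- The directional derivative `∂p/∂v`. -/
noncomputable def dirDeriv (v : Fin 4 → L) (p : MvPolynomial (Fin 4) L) :
    MvPolynomial (Fin 4) L :=
  ∑ j, MvPolynomial.C (v j) * MvPolynomial.pderiv j p

/-- The resultant of two binary quadratic forms. -/
noncomputable def quadraticResultant (p q : MvPolynomial (Fin 2) L) : L :=
  Polynomial.resultant (dehom p) (dehom q) 2 2

/-- `[A 0 : A 1]` is, where `A` has no zero, a morphism on the surface `f = 0` that agrees with the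
rational map `[t 0 : t 1]`. -/
def RepresentsProjection (f : MvPolynomial (Fin 4) L) (t : Fin 2 → Module.Dual L (Fin 4 → L))
    (A : Fin 2 → MvPolynomial (Fin 4) L) : Prop :=
  (∃ d, ∀ i, (A i).IsHomogeneous d) ∧
    linearPoly (t 1) * A 0 - linearPoly (t 0) * A 1 ∈ Ideal.span {f}

/-- `π : ℓ → ℙ(T^∨)` is the restriction to `ℓ = ℙ(S)` of the morphism from the surface `f = 0` that
extends the projection from `ℓ`, where `T = ann(S)`. The basis `b` of `S` identifies `ℓ` with `ℙ¹`,
and the basis `t` of `T` gives the homogeneous coordinates `[t 0 : t 1]` on `ℙ(T^∨)`. Near every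
geometric point of `ℓ` the extension has a representative `[A 0 : A 1]`, and `π` is given on `ℓ` by
its restriction. -/
def IsResidualProjection (f : MvPolynomial (Fin 4) L) {S : Submodule L (Fin 4 → L)}
    (b : Module.Basis (Fin 2) L S) (t : Module.Basis (Fin 2) L S.dualAnnihilator)
    (π : P1Map L) : Prop :=
  ∃ P : FormPair L, Quotient.mk (FormPair.setoid L) P = π ∧
    ∀ v : Fin 2 → AlgebraicClosure L, v ≠ 0 →
      ∃ A : Fin 2 → MvPolynomial (Fin 4) L,
        RepresentsProjection f (fun m => (t m : Module.Dual L (Fin 4 → L))) A ∧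
        (∃ i, MvPolynomial.aeval v (restrictTo (fun m => (b m : Fin 4 → L)) (A i)) ≠ 0) ∧
        P.form 0 * restrictTo (fun m => (b m : Fin 4 → L)) (A 1) =
          P.form 1 * restrictTo (fun m => (b m : Fin 4 → L)) (A 0)

/-- The group of automorphisms `i` of `ℙ¹` with `π ∘ i = π`. -/
noncomputable def galoisGroup (π : P1Map L) : Subgroup (P1Map L)ˣ where
  carrier := {i | π * (i : P1Map L) = π}
  one_mem' := mul_one π
  mul_mem' := fun {i j} (hi : π * (i : P1Map L) = π) (hj : π * (j : P1Map L) = π) => by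
    change π * ((i * j : (P1Map L)ˣ) : P1Map L) = π
    rw [Units.val_mul, ← mul_assoc, hi, hj]
  inv_mem' := fun {i} (hi : π * (i : P1Map L) = π) => by
    change π * ((i⁻¹ : (P1Map L)ˣ) : P1Map L) = π
    rw [Units.mul_inv_eq_iff_eq_mul, hi]

/-- `i` is a nontrivial element of the Galois group of `ℓ → ℙ(T^∨)`. -/
def IsAssociatedInvolution (f : MvPolynomial (Fin 4) L) {S : Submodule L (Fin 4 → L)}
    (b : Module.Basis (Fin 2) L S) (t : Module.Basis (Fin 2) L S.dualAnnihilator)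
    (i : (P1Map L)ˣ) : Prop :=
  ∃ π : P1Map L, IsResidualProjection f b t π ∧ i ∈ galoisGroup π ∧ i ≠ 1

end CubicSurface

/-! Write `F` for the cubic over `L`. Since `F` vanishes on the line, `F = t₀ B₀ + t₁ B₁`, with
`t₀`, `t₁` a basis of the linear forms vanishing on the line and `B₀`, `B₁` quadratic forms. On the
surface `t₀ B₀ = -t₁ B₁`, so `[t₀ : t₁] = [B₁ : -B₀]`, and the right side extends the projection
across the line: a common zero of `B₀`, `B₁` on the line would be a singular point, because all
partial derivatives of `F` would vanish there. Hence `π` is the degree-two morphism `[B₁ : -B₀]`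
restricted to the line; `isResidualProjection_iff` also shows that no other morphism qualifies.

For any degree-two morphism `[p : q]`, with `p = a x² + b x y + c y²` and `q` the same with primes,
put `A = ab' - a'b`, `B = ac' - a'c`, `C = bc' - b'c`. Then `(p(X) q(Y) - p(Y) q(X)) / (X - Y) = A X
Y + B (X + Y) + C`. Two distinct points of a fibre make this vanish, so the involution is `z ↦ (B z
+ C) / (-A z - B)`. Its determinant is `-(B² - AC)`, and `B² - AC` is the resultant of `p` and `q`.
Thus its degree is `⟨-Res(p, q)⟩`, which explains the factor `⟨-1⟩` (`exists_unique_involution`).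

It remains to compare resultants modulo squares. On the line, `∂F/∂eᵢ = ∑ tₘ(eᵢ) Bₘ`, so passing
from the `Bₘ` to the two derivatives multiplies the resultant by a squared determinant. Changing the
basis of `S` multiplies it by the fourth power of a determinant. Neither affects the class in `GW
L`. -/

theorem MvPolynomial.IsHomogeneous.homogeneousComponent_mul {σ R : Type*} [CommRing R]
    {p : MvPolynomial σ R} {m : ℕ} (hp : p.IsHomogeneous m) (q : MvPolynomial σ R) (n : ℕ) :
    homogeneousComponent (m + n) (p * q) = p * homogeneousComponent n q := by
  conv_lhs => rw [← sum_homogeneousComponent q, Finset.mul_sum, map_sum]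
  have h : ∀ i, homogeneousComponent (m + n) (p * homogeneousComponent i q) =
      if i = n then p * homogeneousComponent n q else 0 := fun i => by
    rw [homogeneousComponent_of_mem (hp.mul (homogeneousComponent_isHomogeneous i q))]
    by_cases hi : i = n
    · simp [hi]
    · rw [if_neg (by omega), if_neg hi]
  simp only [h]
  rw [Finset.sum_ite_eq']
  split_ifs with hn
  · rfl
  · rw [homogeneousComponent_eq_zero, mul_zero]
    simpa using hn

/-! ### Binary forms, dehomogenization and the resultant of two quadratics -/

section BinaryForms

variable {K : Type u} [Field K]

theorem dehom_mul (p q : MvPolynomial (Fin 2) K) : dehom (p * q) = dehom p * dehom q :=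
  map_mul _ p q

theorem dehom_coeff_of_isHomogeneous {p : MvPolynomial (Fin 2) K} {n : ℕ}
    (hp : p.IsHomogeneous n) (m : Fin 2 →₀ ℕ) (hm : m 0 + m 1 = n) :
    (dehom p).coeff (m 0) = p.coeff m := by
  rw [FormPair.dehom_eq_sum, Polynomial.finsetSum_coeff]
  have h : ∀ m' ∈ p.support, (Polynomial.C (p.coeff m') * Polynomial.X ^ (m' 0)).coeff (m 0) =
      if m' = m then p.coeff m else 0 := fun m' hm' => by
    have := FormPair.exponents_add hp hm'
    rw [Polynomial.coeff_C_mul_X_pow]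
    by_cases h0 : m 0 = m' 0
    · have : m' = m := by
        ext i
        fin_cases i
        · exact h0.symm
        · change m' 1 = m 1
          omega
      simp [this]
    · rw [if_neg h0, if_neg]
      rintro rfl
      exact h0 rfl
  rw [Finset.sum_congr rfl h, Finset.sum_ite_eq']
  split_ifs with hs
  · rfl
  · exact (MvPolynomial.notMem_support_iff.1 hs).symm

/-- In a fixed degree the exponent of the first variable determines that of the second, so setting
the second variable to `1` loses nothing. This carries identities of univariate polynomials back to
binary forms. -/
theorem eq_of_dehom_eq {p q : MvPolynomial (Fin 2) K} {n : ℕ} (hp : p.IsHomogeneous n)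
    (hq : q.IsHomogeneous n) (h : dehom p = dehom q) : p = q := by
  have key : ∀ {r : MvPolynomial (Fin 2) K}, r.IsHomogeneous n → ∀ m : Fin 2 →₀ ℕ,
      m 0 + m 1 ≠ n → r.coeff m = 0 := fun hr m hm => by
    by_contra hne
    exact hm (FormPair.exponents_add hr (MvPolynomial.mem_support_iff.2 hne))
  ext m
  by_cases hm : m 0 + m 1 = n
  · rw [← dehom_coeff_of_isHomogeneous hp m hm, ← dehom_coeff_of_isHomogeneous hq m hm, h]
  · rw [key hp m hm, key hq m hm]

/-- The binary linear form with coefficients `a`, `b`. -/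
noncomputable def linForm (a b : K) : MvPolynomial (Fin 2) K :=
  MvPolynomial.C a * MvPolynomial.X 0 + MvPolynomial.C b * MvPolynomial.X 1

/-- The binary quadratic form with coefficients `a`, `b`, `c`. -/
noncomputable def quadForm (a b c : K) : MvPolynomial (Fin 2) K :=
  MvPolynomial.C a * MvPolynomial.X 0 ^ 2 +
    MvPolynomial.C b * (MvPolynomial.X 0 * MvPolynomial.X 1) +
    MvPolynomial.C c * MvPolynomial.X 1 ^ 2

theorem linForm_isHomogeneous (a b : K) : (linForm a b).IsHomogeneous 1 :=
  ((MvPolynomial.isHomogeneous_X K 0).C_mul a).add ((MvPolynomial.isHomogeneous_X K 1).C_mul b)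

theorem quadForm_isHomogeneous (a b c : K) : (quadForm a b c).IsHomogeneous 2 := by
  have hX := MvPolynomial.isHomogeneous_X (σ := Fin 2) K
  exact ((((hX 0).pow 2).C_mul a).add (((hX 0).mul (hX 1)).C_mul b)).add (((hX 1).pow 2).C_mul c)

theorem dehom_linForm (a b : K) :
    dehom (linForm a b) = Polynomial.C a * Polynomial.X + Polynomial.C b := by
  simp [dehom, linForm]

theorem dehom_quadForm (a b c : K) : dehom (quadForm a b c) =
    Polynomial.C a * Polynomial.X ^ 2 + Polynomial.C b * Polynomial.X + Polynomial.C c := by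
  simp [dehom, quadForm]

theorem exists_eq_quadForm {p : MvPolynomial (Fin 2) K} (hp : p.IsHomogeneous 2) :
    ∃ a b c, p = quadForm a b c := by
  refine ⟨(dehom p).coeff 2, (dehom p).coeff 1, (dehom p).coeff 0,
    eq_of_dehom_eq hp (quadForm_isHomogeneous _ _ _) ?_⟩
  rw [dehom_quadForm]
  exact Polynomial.eq_quadratic_of_degree_le_two
    (Polynomial.natDegree_le_iff_degree_le.1 (FormPair.natDegree_dehom_le hp))

/-- The Sylvester determinant, written in the 2×2 minors of the coefficient matrix; it is minus the
determinant of the Bézout matrix. The formal degrees are fixed at 2, so leading coefficients may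
vanish. -/
theorem quadraticResultant_quadForm (a b c a' b' c' : K) :
    quadraticResultant (quadForm a b c) (quadForm a' b' c') =
      (a * c' - a' * c) ^ 2 - (a * b' - a' * b) * (b * c' - b' * c) := by
  have e : ∀ a b c : K, (dehom (quadForm a b c)).coeff 0 = c ∧
      (dehom (quadForm a b c)).coeff 1 = b ∧ (dehom (quadForm a b c)).coeff 2 = a := by
    intro a b c
    simp [dehom_quadForm, Polynomial.coeff_X, Polynomial.coeff_C]
  obtain ⟨h0, h1, h2⟩ := e a b c
  obtain ⟨h0', h1', h2'⟩ := e a' b' c'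
  have hM : Polynomial.sylvester (dehom (quadForm a b c)) (dehom (quadForm a' b' c')) 2 2 =
      !![c', 0, c, 0; b', c', b, c; a', b', a, b; 0, a', 0, a] := by
    ext i j
    fin_cases i <;> fin_cases j <;>
      simp [Polynomial.sylvester, Fin.addCases, h0, h1, h2, h0', h1', h2']
  rw [quadraticResultant, Polynomial.resultant, hM]
  simp [Matrix.det_succ_row_zero, Fin.sum_univ_succ, Fin.succAbove]
  ring

end BinaryForms

/-! ### Equality of morphisms by cross products -/

namespace FormPair

variable {K : Type u} [Field K]

/-- Pairs of forms are equivalent as soon as their cross product vanishes. -/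
theorem equiv_of_cross {F G : FormPair K}
    (h : F.form 0 * G.form 1 = F.form 1 * G.form 0) : F ≈ G := by
  have h' : dehom (F.form 0) * dehom (G.form 1) = dehom (F.form 1) * dehom (G.form 0) := by
    rw [← dehom_mul, ← dehom_mul, h]
  obtain ⟨hF0, hF1, hF, a, b, hab⟩ := F.bezout_conditions
  obtain ⟨hG0, hG1, hG, hcop⟩ := G.bezout_conditions
  -- Multiplying `gᵢ` by `a f₀ + b f₁ = 1` and using the cross relation gives `gᵢ = w fᵢ`. Then `w`
  -- divides the coprime pair `g₀`, `g₁`, so it is a nonzero constant.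
  set w := a * dehom (G.form 0) + b * dehom (G.form 1)
  have e0 : dehom (G.form 0) = w * dehom (F.form 0) := by
    linear_combination -dehom (G.form 0) * hab - b * h'
  have e1 : dehom (G.form 1) = w * dehom (F.form 1) := by
    linear_combination -dehom (G.form 1) * hab + a * h'
  obtain ⟨c, hc, hcw⟩ := Polynomial.isUnit_iff.1
    (hcop.isUnit_of_dvd' (Dvd.intro _ e0.symm) (Dvd.intro _ e1.symm))
  rw [← hcw] at e0 e1
  -- The degree of a pair is the larger of the degrees of its two dehomogenizations, which a nonzero
  -- constant factor preserves.
  have hdeg : F.deg = G.deg := by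
    have d0 := Polynomial.natDegree_C_mul (p := dehom (F.form 0)) hc.ne_zero
    have d1 := Polynomial.natDegree_C_mul (p := dehom (F.form 1)) hc.ne_zero
    rw [← e0] at d0
    rw [← e1] at d1
    omega
  refine ⟨hc.unit, fun i => ?_⟩
  refine eq_of_dehom_eq (G.homog i) ?_ ?_
  · rw [← hdeg]
    exact (F.homog i).C_mul _
  · rw [dehom_mul]
    have : dehom (MvPolynomial.C (hc.unit : K) : MvPolynomial (Fin 2) K) = Polynomial.C c := by
      simp [dehom]
    rw [this]
    fin_cases i
    · exact e0
    · exact e1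

theorem cross_of_equiv {F G : FormPair K} (h : F ≈ G) :
    F.form 0 * G.form 1 = F.form 1 * G.form 0 := by
  obtain ⟨c, hc⟩ := h
  rw [hc, hc]
  ring

end FormPair

/-! ### Rank-one classes in the Grothendieck–Witt ring -/

namespace GW

variable {K : Type u} [Field K]

theorem unitCls_mul (a b : Kˣ) : unitCls a * unitCls b = unitCls (a * b) := by
  refine (mulHom_of _ _).trans (congrArg of (Quotient.sound ?_))
  exact SymBilinSpace.tensor_isometric (A := SymBilinSpace.rankOne a)
    (B := SymBilinSpace.rankOne b) (C := SymBilinSpace.rankOne (a * b))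
    (TensorProduct.lid K K) fun (x : K) (y : K) (z : K) (w : K) => by
      change ((a * b : Kˣ) : K) * ((x * y) * (z * w)) = ((a : K) * (x * z)) * ((b : K) * (y * w))
      push_cast
      ring

/-- Multiplication by `u` is an isometry; this absorbs every change-of-basis determinant below. -/
theorem unitCls_mul_sq (a u : Kˣ) : unitCls (a * u ^ 2) = unitCls a := by
  refine congrArg of (Quotient.sound ⟨LinearEquiv.smulOfUnit u, fun (x : K) (y : K) => ?_⟩)
  change (a : K) * (((u : K) * x) * ((u : K) * y)) = ((a * u ^ 2 : Kˣ) : K) * (x * y)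
  push_cast
  ring

end GW

/-! ### The involution of a degree-two morphism -/

namespace FormPair

variable {K : Type u} [Field K]

/-- The morphism `ℙ¹ → ℙ¹` given by a pair of forms. -/
noncomputable def toP1Map (F : FormPair K) : P1Map K := Quotient.mk (FormPair.setoid K) F

theorem toP1Map_eq_of_cross {F G : FormPair K}
    (h : F.form 0 * G.form 1 = F.form 1 * G.form 0) : toP1Map F = toP1Map G :=
  Quotient.sound (equiv_of_cross h)

/-- The automorphism `[x : y] ↦ [α x + β y : γ x + δ y]` of `ℙ¹`. -/
noncomputable def linear (α β γ δ : K) (h : α * δ - β * γ ≠ 0) : FormPair K where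
  deg := 1
  form := ![linForm α β, linForm γ δ]
  homog := fun i => by
    fin_cases i
    · exact linForm_isHomogeneous α β
    · exact linForm_isHomogeneous γ δ
  basePointFree := fun v hv => by
    by_contra! h0
    have h1 := h0 0
    have h2 := h0 1
    simp only [Matrix.cons_val_zero, Matrix.cons_val_one, linForm, map_add, map_mul,
      MvPolynomial.aeval_X, MvPolynomial.aeval_C] at h1 h2
    have hd : algebraMap K (AlgebraicClosure K) (α * δ - β * γ) ≠ 0 := by
      rwa [Ne, map_eq_zero_iff _ (algebraMap K (AlgebraicClosure K)).injective]
    simp only [map_sub, map_mul] at hd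
    refine hv (funext (Fin.forall_fin_two.2 ⟨?_, ?_⟩))
    · refine (mul_eq_zero.1 ?_).resolve_left hd
      linear_combination algebraMap K _ δ * h1 - algebraMap K _ β * h2
    · refine (mul_eq_zero.1 ?_).resolve_left hd
      linear_combination algebraMap K _ α * h2 - algebraMap K _ γ * h1

theorem a1Degree_linear (α β γ δ : K) (h : α * δ - β * γ ≠ 0) :
    P1Map.a1Degree (toP1Map (linear α β γ δ h)) =
      GW.unitCls (Units.mk0 _ h) := by
  refine congrArg GW.of (Quotient.sound ⟨LinearEquiv.funUnique (Fin 1) K K,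
    fun (x : Fin 1 → K) (y : Fin 1 → K) => ?_⟩)
  have hc : Bezout.coeff (dehom (linForm α β)) (dehom (linForm γ δ)) 0 0 = α * δ - β * γ := by
    simp [Bezout.coeff, dehom_linForm, Polynomial.coeff_X, Polynomial.coeff_C]
  change (α * δ - β * γ) * (x 0 * y 0) = Matrix.toBilin' (Matrix.of fun p q : Fin 1 =>
    Bezout.coeff (dehom (linForm α β)) (dehom (linForm γ δ)) p q) x y
  rw [Matrix.toBilin'_apply]
  simp [hc]
  ring

theorem aeval_quadForm {A : Type*} [CommRing A] [Algebra K A] (g : Fin 2 → A) (a b c : K) :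
    MvPolynomial.aeval g (quadForm a b c) = algebraMap K A a * g 0 ^ 2 +
      algebraMap K A b * (g 0 * g 1) + algebraMap K A c * g 1 ^ 2 := by
  simp [quadForm]

/-- The resultant of a base point free pair of quadratic forms does not vanish. -/
theorem resultant_ne_zero (P : FormPair K) (hP : P.deg = 2) :
    quadraticResultant (P.form 0) (P.form 1) ≠ 0 := by
  obtain ⟨n, form, homog, bpf⟩ := P
  obtain rfl : n = 2 := hP
  set P : FormPair K := ⟨2, form, homog, bpf⟩
  change quadraticResultant (form 0) (form 1) ≠ 0
  obtain ⟨a, b, c, h0⟩ := exists_eq_quadForm (homog 0)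
  obtain ⟨a', b', c', h1⟩ := exists_eq_quadForm (homog 1)
  intro hres
  rw [h0, h1, quadraticResultant_quadForm] at hres
  -- The Bézout matrix has determinant minus the resultant, so a zero resultant would contradict the
  -- nondegeneracy already proved for the Bézout form.
  have hform : ∀ x y : Fin 2 → K, P.bezoutSpace.form x y =
      (b * c' - b' * c) * (x 0 * y 0) + (a * c' - a' * c) * (x 0 * y 1 + x 1 * y 0) +
        (a * b' - a' * b) * (x 1 * y 1) := fun x y => by
    change Matrix.toBilin' (Matrix.of fun p q : Fin 2 =>
      Bezout.coeff (dehom (form 0)) (dehom (form 1)) p q) x y = _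
    rw [Matrix.toBilin'_apply, h0, h1]
    simp [Fin.sum_univ_two, Bezout.coeff, dehom_quadForm, Finset.sum_range_succ,
      Polynomial.coeff_X, Polynomial.coeff_C]
    ring
  have hnd : ∀ x : Fin 2 → K, (∀ y : Fin 2 → K, P.bezoutSpace.form x y = 0) → x = 0 :=
    P.bezoutSpace.nondeg
  -- Up to sign a column of the adjugate of the Bézout matrix, hence in the radical when the
  -- determinant vanishes.
  have hx := hnd ![a * c' - a' * c, -(b * c' - b' * c)] fun y => by
    rw [hform]
    simp
    linear_combination y 1 * hres
  have hB := congrFun hx 0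
  have hC := congrFun hx 1
  simp only [Matrix.cons_val_zero, Matrix.cons_val_one, Pi.zero_apply, neg_eq_zero] at hB hC
  have hx := hnd ![a * b' - a' * b, 0] fun y => by
    rw [hform, hB, hC]
    simp
  have hA := congrFun hx 0
  simp only [Matrix.cons_val_zero, Pi.zero_apply] at hA
  have := congrFun (hnd ![1, 0] fun y => by rw [hform, hA, hB, hC]; simp) 0
  simp at this

/-- A morphism `ℙ¹ → ℙ¹` of degree two has exactly one nontrivial automorphism over its target. -/
theorem exists_unique_involution (h2 : (2 : K) ≠ 0) (P : FormPair K) (hP : P.deg = 2)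
    (hres : quadraticResultant (P.form 0) (P.form 1) ≠ 0) :
    ∃ i : (P1Map K)ˣ, (i ∈ galoisGroup (toP1Map P) ∧ i ≠ 1) ∧
      (∀ j : (P1Map K)ˣ, j ∈ galoisGroup (toP1Map P) ∧ j ≠ 1 → j = i) ∧
      GW.unitCls (-1) * P1Map.a1Degree (i : P1Map K) = GW.unitCls (Units.mk0 _ hres) := by
  obtain ⟨n, form, homog, bpf⟩ := P
  obtain rfl : n = 2 := hP
  set P : FormPair K := ⟨2, form, homog, bpf⟩
  change quadraticResultant (form 0) (form 1) ≠ 0 at hres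
  obtain ⟨a, b, c, h0⟩ := exists_eq_quadForm (homog 0)
  obtain ⟨a', b', c', h1⟩ := exists_eq_quadForm (homog 1)
  have hr : quadraticResultant (form 0) (form 1) =
      (a * c' - a' * c) ^ 2 - (a * b' - a' * b) * (b * c' - b' * c) := by
    rw [h0, h1, quadraticResultant_quadForm]
  obtain ⟨A, hA⟩ : ∃ A, A = a * b' - a' * b := ⟨_, rfl⟩
  obtain ⟨B, hB⟩ : ∃ B, B = a * c' - a' * c := ⟨_, rfl⟩
  obtain ⟨C, hC⟩ : ∃ C, C = b * c' - b' * c := ⟨_, rfl⟩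
  rw [← hA, ← hB, ← hC] at hr
  -- The determinant of the involution is minus the resultant.
  have hdet : B * -B - C * -A ≠ 0 := by
    rw [hr] at hres
    contrapose! hres
    linear_combination -hres
  set J := linear B C (-A) (-B) hdet
  -- The matrix of `J` has trace zero, so its square is the scalar `B² - AC`.
  have hJJ : toP1Map J * toP1Map J = 1 := by
    refine toP1Map_eq_of_cross (F := comp J J) (G := FormPair.id K) ?_
    change MvPolynomial.aeval ![linForm B C, linForm (-A) (-B)] (linForm B C) * MvPolynomial.X 1 =
      MvPolynomial.aeval ![linForm B C, linForm (-A) (-B)] (linForm (-A) (-B)) * MvPolynomial.X 0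
    simp [linForm, MvPolynomial.algebraMap_eq]
    ring
  have hPJ : toP1Map P * toP1Map J =
      toP1Map P := by
    refine toP1Map_eq_of_cross (F := comp P J) ?_
    change MvPolynomial.aeval ![linForm B C, linForm (-A) (-B)] (form 0) * form 1 =
      MvPolynomial.aeval ![linForm B C, linForm (-A) (-B)] (form 1) * form 0
    rw [h0, h1, aeval_quadForm, aeval_quadForm, hA, hB, hC]
    simp only [quadForm, linForm, MvPolynomial.algebraMap_eq, Matrix.cons_val_zero,
      Matrix.cons_val_one, map_neg, map_sub, map_mul]
    ring
  -- If `J` were the identity, its matrix would be scalar: `A = C = 0` and `B = -B`. Characteristic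
  -- different from 2 then forces `B = 0`, against `hdet`.
  have hJ1 : toP1Map J ≠ 1 := fun h => by
    have h := cross_of_equiv (Quotient.exact h)
    change linForm B C * MvPolynomial.X 1 = linForm (-A) (-B) * MvPolynomial.X 0 at h
    have e : ∀ x y : K, (B * x + C * y) * y = (-A * x + -B * y) * x := fun x y => by
      have := congrArg (MvPolynomial.aeval ![x, y]) h
      simpa [linForm] using this
    have eC := e 0 1
    have eA := e 1 0
    have eB := e 1 1
    simp only [mul_zero, mul_one, zero_add, add_zero] at eA eB eC
    have hC0 : C = 0 := by linear_combination eC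
    have hA0 : A = 0 := by linear_combination eA
    rw [hA0, hC0] at eB
    have hB0 : B = 0 := (mul_eq_zero.1 (show 2 * B = 0 by linear_combination eB)).resolve_left h2
    exact hdet (by rw [hA0, hB0]; ring)
  refine ⟨⟨toP1Map J, toP1Map J, hJJ, hJJ⟩,
    ⟨hPJ, fun h => hJ1 (congrArg Units.val h)⟩, ?_, ?_⟩
  · rintro j ⟨hj, hj1⟩
    obtain ⟨I, hI : toP1Map I = j⟩ := Quotient.exists_rep (j : P1Map K)
    change toP1Map P * (j : P1Map K) =
      toP1Map P at hj
    rw [← hI] at hj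
    have hcross := cross_of_equiv (Quotient.exact hj)
    change MvPolynomial.aeval I.form (form 0) * form 1 =
      MvPolynomial.aeval I.form (form 1) * form 0 at hcross
    refine Units.ext ?_
    rw [← hI]
    refine toP1Map_eq_of_cross ?_
    change I.form 0 * linForm (-A) (-B) = I.form 1 * linForm B C
    -- The cross relation for `P ∘ I = P` is a product: this factor, zero only for the identity,
    -- times the Bézout polynomial evaluated at a point and its image. Cancelling in a domain leaves
    -- the equation of `J`, whatever the degree of the pair `I`.
    have hne : MvPolynomial.X 0 * I.form 1 - MvPolynomial.X 1 * I.form 0 ≠ 0 := fun h => by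
      refine hj1 (Units.ext ?_)
      rw [← hI]
      refine toP1Map_eq_of_cross (G := FormPair.id K) ?_
      change I.form 0 * MvPolynomial.X 1 = I.form 1 * MvPolynomial.X 0
      linear_combination -h
    refine mul_left_cancel₀ hne ?_
    rw [h0, h1, aeval_quadForm, aeval_quadForm] at hcross
    rw [hA, hB, hC]
    simp only [quadForm, linForm, MvPolynomial.algebraMap_eq, map_neg, map_sub, map_mul] at *
    linear_combination hcross
  · change GW.unitCls (-1) * P1Map.a1Degree (toP1Map J) = _
    rw [a1Degree_linear, GW.unitCls_mul]
    congr 1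
    ext
    simp only [Units.val_mul, Units.val_neg, Units.val_one, Units.val_mk0]
    rw [hr]
    ring

end FormPair

/-! ### Restriction to a line, directional derivatives and base change of smoothness -/

section Restriction

variable {L : Type u} [Field L]

theorem LinearMap.apply_eq_sum_single {M : Type*} [AddCommGroup M] [Module L M]
    (g : (Fin 4 → L) →ₗ[L] M) (v : Fin 4 → L) : g v = ∑ j, v j • g (Pi.single j 1) := by
  conv_lhs => rw [← Finset.univ_sum_single v, map_sum]
  refine Finset.sum_congr rfl fun j _ => ?_
  rw [← map_smul, ← Pi.single_smul, smul_eq_mul, mul_one]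

theorem restrictTo_add (w : Fin 2 → Fin 4 → L) (p q : MvPolynomial (Fin 4) L) :
    restrictTo w (p + q) = restrictTo w p + restrictTo w q := map_add _ p q

theorem restrictTo_sub (w : Fin 2 → Fin 4 → L) (p q : MvPolynomial (Fin 4) L) :
    restrictTo w (p - q) = restrictTo w p - restrictTo w q := map_sub _ p q

theorem restrictTo_neg (w : Fin 2 → Fin 4 → L) (p : MvPolynomial (Fin 4) L) :
    restrictTo w (-p) = -restrictTo w p := map_neg _ p

theorem restrictTo_mul (w : Fin 2 → Fin 4 → L) (p q : MvPolynomial (Fin 4) L) :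
    restrictTo w (p * q) = restrictTo w p * restrictTo w q := map_mul _ p q

theorem restrictTo_C (w : Fin 2 → Fin 4 → L) (a : L) :
    restrictTo w (MvPolynomial.C a) = MvPolynomial.C a := MvPolynomial.aeval_C _ a

theorem restrictTo_isHomogeneous (w : Fin 2 → Fin 4 → L) {p : MvPolynomial (Fin 4) L} {n : ℕ}
    (hp : p.IsHomogeneous n) : (restrictTo w p).IsHomogeneous n := by
  rw [← one_mul n]
  exact hp.aeval (fun j => ∑ m, MvPolynomial.C (w m j) * MvPolynomial.X m) fun j => MvPolynomial.IsHomogeneous.sum _ _ _ fun m _ =>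
      (MvPolynomial.isHomogeneous_X L m).C_mul _

theorem linearPoly_isHomogeneous (φ : Module.Dual L (Fin 4 → L)) :
    (linearPoly φ).IsHomogeneous 1 :=
  MvPolynomial.IsHomogeneous.sum _ _ _ fun j _ => (MvPolynomial.isHomogeneous_X L j).C_mul _

theorem linearPoly_combination {ι : Type*} [Fintype ι] (c : ι → L)
    (φ : ι → Module.Dual L (Fin 4 → L)) :
    linearPoly (∑ m, c m • φ m) = ∑ m, MvPolynomial.C (c m) * linearPoly (φ m) := by
  simp only [linearPoly, LinearMap.sum_apply, LinearMap.smul_apply, smul_eq_mul, map_sum, map_mul,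
    Finset.sum_mul, Finset.mul_sum]
  rw [Finset.sum_comm]
  simp only [mul_assoc]

theorem aeval_restrictTo {A : Type*} [CommRing A] [Algebra L A] (w : Fin 2 → Fin 4 → L)
    (v : Fin 2 → A) (p : MvPolynomial (Fin 4) L) :
    MvPolynomial.aeval v (restrictTo w p) =
      MvPolynomial.aeval (fun j => ∑ m, algebraMap L A (w m j) * v m) p := by
  rw [restrictTo, MvPolynomial.comp_aeval_apply]
  simp

/-- The algebra `A` is arbitrary so as to cover both the generic point of the line (polynomial
values, as in `restrictTo`) and its geometric points. -/
theorem aeval_linearPoly_eq_zero {A : Type*} [CommRing A] [Algebra L A] {w : Fin 2 → Fin 4 → L}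
    (v : Fin 2 → A) {φ : Module.Dual L (Fin 4 → L)} (h : ∀ m, φ (w m) = 0) :
    MvPolynomial.aeval (fun j => ∑ m, algebraMap L A (w m j) * v m) (linearPoly φ) = 0 := by
  have e : ∀ m, ∑ j, φ (Pi.single j 1) * w m j = 0 := fun m => by
    rw [← h m, φ.apply_eq_sum_single]
    exact Finset.sum_congr rfl fun j _ => mul_comm _ _
  simp only [linearPoly, map_sum, map_mul, MvPolynomial.aeval_C, MvPolynomial.aeval_X,
    Finset.mul_sum]
  rw [Finset.sum_comm]
  refine Finset.sum_eq_zero fun m _ => ?_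
  simp only [← mul_assoc, ← map_mul, ← Finset.sum_mul, ← map_sum, e, map_zero, zero_mul]

theorem restrictTo_linearPoly_eq_zero {w : Fin 2 → Fin 4 → L} {φ : Module.Dual L (Fin 4 → L)}
    (h : ∀ m, φ (w m) = 0) : restrictTo w (linearPoly φ) = 0 :=
  aeval_linearPoly_eq_zero MvPolynomial.X h

theorem dirDeriv_mul (v : Fin 4 → L) (p q : MvPolynomial (Fin 4) L) :
    dirDeriv v (p * q) = p * dirDeriv v q + q * dirDeriv v p := by
  simp only [dirDeriv, Derivation.leibniz, smul_eq_mul, mul_add, Finset.sum_add_distrib,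
    Finset.mul_sum]
  congr 1 <;> exact Finset.sum_congr rfl fun j _ => by ring

theorem dirDeriv_add (v : Fin 4 → L) (p q : MvPolynomial (Fin 4) L) :
    dirDeriv v (p + q) = dirDeriv v p + dirDeriv v q := by
  simp [dirDeriv, mul_add, Finset.sum_add_distrib]

theorem pderiv_linearPoly (j : Fin 4) (φ : Module.Dual L (Fin 4 → L)) :
    MvPolynomial.pderiv j (linearPoly φ) = MvPolynomial.C (φ (Pi.single j 1)) := by
  simp [linearPoly, MvPolynomial.pderiv_X, Pi.single_apply]

theorem dirDeriv_linearPoly (v : Fin 4 → L) (φ : Module.Dual L (Fin 4 → L)) :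
    dirDeriv v (linearPoly φ) = MvPolynomial.C (φ v) := by
  simp only [dirDeriv, pderiv_linearPoly, ← map_mul, ← map_sum]
  rw [φ.apply_eq_sum_single v]
  rfl

/-- The derivative of a multiple of a linear form vanishing on a plane, restricted to the plane. -/
theorem restrictTo_dirDeriv_linearPoly_mul {w : Fin 2 → Fin 4 → L}
    {φ : Module.Dual L (Fin 4 → L)} (h : ∀ m, φ (w m) = 0) (v : Fin 4 → L)
    (p : MvPolynomial (Fin 4) L) :
    restrictTo w (dirDeriv v (linearPoly φ * p)) = MvPolynomial.C (φ v) * restrictTo w p := by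
  rw [dirDeriv_mul, restrictTo_add, restrictTo_mul, restrictTo_mul,
    restrictTo_linearPoly_eq_zero h, dirDeriv_linearPoly, restrictTo_C]
  ring

/-- Change of coordinates on a plane. -/
theorem restrictTo_change (w w' : Fin 2 → Fin 4 → L) (N : Matrix (Fin 2) (Fin 2) L)
    (h : ∀ m, w' m = ∑ n, N m n • w n) (p : MvPolynomial (Fin 4) L) :
    restrictTo w' p = MvPolynomial.aeval
      (fun n => ∑ m, MvPolynomial.C (N m n) * MvPolynomial.X m) (restrictTo w p) := by
  rw [restrictTo, restrictTo, MvPolynomial.comp_aeval_apply]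
  congr 2
  ext1 j
  simp [h, Fin.sum_univ_two, MvPolynomial.algebraMap_eq]
  ring

/-- Linear independence survives extension of scalars: a left inverse with entries in `L` still
recovers `v` over `A`. -/
theorem sum_algebraMap_mul_ne_zero {A : Type*} [Field A] [Algebra L A] {w : Fin 2 → Fin 4 → L}
    (hw : LinearIndependent L w) {v : Fin 2 → A} (hv : v ≠ 0) :
    (fun j => ∑ m, algebraMap L A (w m j) * v m) ≠ 0 := by
  intro h
  obtain ⟨g, hg⟩ := LinearMap.exists_leftInverse_of_injective (Fintype.linearCombination L w)
    (LinearMap.ker_eq_bot.2 hw.fintypeLinearCombination_injective)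
  have hgw : ∀ m, g (w m) = Pi.single m 1 := fun m => by
    have := LinearMap.congr_fun hg (Pi.single m 1)
    simpa [Fintype.linearCombination_apply_single] using this
  refine hv (funext fun n => ?_)
  have hsum : ∀ m, ∑ j, g (Pi.single j 1) n * w m j = (Pi.single m 1 : Fin 2 → L) n := fun m => by
    rw [← hgw m, g.apply_eq_sum_single, Finset.sum_apply]
    exact Finset.sum_congr rfl fun j _ => mul_comm _ _
  have h' : ∑ j, algebraMap L A (g (Pi.single j 1) n) *
      ∑ m, algebraMap L A (w m j) * v m = 0 :=
    Finset.sum_eq_zero fun j _ => by rw [congrFun h j, Pi.zero_apply, mul_zero]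
  simp only [Finset.mul_sum] at h'
  rw [Finset.sum_comm] at h'
  simp only [← mul_assoc, ← map_mul, ← Finset.sum_mul, ← map_sum, hsum] at h'
  fin_cases n <;> simpa [Fin.sum_univ_two] using h'

/-- Since `L` is algebraic over `k`, its algebraic closure embeds over `k` into that of `k`, which
carries a singular geometric point over `L` to one over `k`. -/
theorem IsSmoothSurface.map {k : Type v} [Field k] [Algebra k L] [Algebra.IsAlgebraic k L]
    {f : MvPolynomial (Fin 4) k} (hf : IsSmoothSurface f) :
    IsSmoothSurface (MvPolynomial.map (algebraMap k L) f) := by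
  intro v hv h
  have : Algebra.IsAlgebraic k (AlgebraicClosure L) := Algebra.IsAlgebraic.trans k L _
  let σ : AlgebraicClosure L →ₐ[k] AlgebraicClosure k := IsAlgClosed.lift
  have key : ∀ p : MvPolynomial (Fin 4) k, MvPolynomial.aeval (fun j => σ (v j)) p =
      σ (MvPolynomial.aeval v (MvPolynomial.map (algebraMap k L) p)) := fun p => by
    rw [MvPolynomial.aeval_map_algebraMap]
    exact (MvPolynomial.comp_aeval_apply v σ p).symm
  obtain ⟨j, hj⟩ := hf (fun j => σ (v j))
    (fun h0 => hv (funext fun j => (map_eq_zero σ).1 (congrFun h0 j)))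
    (by rw [key, h, map_zero])
  refine ⟨j, fun h0 => hj ?_⟩
  rw [key, ← MvPolynomial.pderiv_map, h0, map_zero]

end Restriction

theorem Module.Basis.eq_zero_of_sum_smul_eq_zero {R V ι : Type*} [Semiring R] [AddCommMonoid V]
    [Module R V] [Fintype ι] (b : Module.Basis ι R V) {c : ι → R}
    (h : ∑ i, c i • b i = 0) : c = 0 := by
  rwa [← b.equivFun_symm_apply, map_eq_zero_iff _ b.equivFun.symm.injective] at h

/-! ### The residual projection of a line on a cubic surface -/

section ResidualProjection

variable {L : Type u} [Field L]

/-- The resultant of a pair of binary quadratic forms under a change of basis of their span. -/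
theorem quadraticResultant_combination {p : Fin 2 → MvPolynomial (Fin 2) L}
    (hp : ∀ m, (p m).IsHomogeneous 2) (M : Matrix (Fin 2) (Fin 2) L) :
    quadraticResultant (∑ m, MvPolynomial.C (M 0 m) * p m) (∑ m, MvPolynomial.C (M 1 m) * p m) =
      quadraticResultant (p 0) (p 1) * M.det ^ 2 := by
  obtain ⟨a, b, c, h0⟩ := exists_eq_quadForm (hp 0)
  obtain ⟨a', b', c', h1⟩ := exists_eq_quadForm (hp 1)
  have h : ∀ i, ∑ m, MvPolynomial.C (M i m) * p m = quadForm (M i 0 * a + M i 1 * a')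
      (M i 0 * b + M i 1 * b') (M i 0 * c + M i 1 * c') := fun i => by
    rw [Fin.sum_univ_two, h0, h1]
    simp only [quadForm, map_add, map_mul]
    ring
  -- Each 2×2 minor of the coefficients is multiplied by `det M`, and the resultant is quadratic in
  -- the minors.
  rw [h, h, h0, h1, quadraticResultant_quadForm, quadraticResultant_quadForm, Matrix.det_fin_two]
  ring

/-- The resultant of a pair of binary quadratic forms under a linear substitution. -/
theorem quadraticResultant_substitution {p : Fin 2 → MvPolynomial (Fin 2) L}
    (hp : ∀ m, (p m).IsHomogeneous 2) (N : Matrix (Fin 2) (Fin 2) L) :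
    quadraticResultant
      (MvPolynomial.aeval (fun n => ∑ m, MvPolynomial.C (N m n) * MvPolynomial.X m) (p 0))
      (MvPolynomial.aeval (fun n => ∑ m, MvPolynomial.C (N m n) * MvPolynomial.X m) (p 1)) =
      quadraticResultant (p 0) (p 1) * (N.det ^ 2) ^ 2 := by
  obtain ⟨a, b, c, h0⟩ := exists_eq_quadForm (hp 0)
  obtain ⟨a', b', c', h1⟩ := exists_eq_quadForm (hp 1)
  have h : ∀ a b c, MvPolynomial.aeval
      (fun n => ∑ m, MvPolynomial.C (N m n) * MvPolynomial.X m) (quadForm a b c) =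
      quadForm (a * N 0 0 ^ 2 + b * (N 0 0 * N 0 1) + c * N 0 1 ^ 2)
        (a * (2 * (N 0 0 * N 1 0)) + b * (N 0 0 * N 1 1 + N 0 1 * N 1 0) +
          c * (2 * (N 0 1 * N 1 1)))
        (a * N 1 0 ^ 2 + b * (N 1 0 * N 1 1) + c * N 1 1 ^ 2) := fun a b c => by
    rw [FormPair.aeval_quadForm]
    simp only [quadForm, Fin.sum_univ_two, MvPolynomial.algebraMap_eq, map_add, map_mul, map_pow,
      map_ofNat]
    ring
  rw [h0, h1, h, h, quadraticResultant_quadForm, quadraticResultant_quadForm, Matrix.det_fin_two]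
  ring

variable {F : MvPolynomial (Fin 4) L} {S : Submodule L (Fin 4 → L)}

/-- A cubic form vanishing on a line is a combination of the equations of the line with quadratic
coefficients. -/
theorem exists_eq_linearPoly_mul_add (hF : F.IsHomogeneous 3) (hline : F ∈ lineIdeal S)
    (t : Module.Basis (Fin 2) L S.dualAnnihilator) :
    ∃ B : Fin 2 → MvPolynomial (Fin 4) L, (∀ m, (B m).IsHomogeneous 2) ∧
      F = linearPoly (t 0 : Module.Dual L (Fin 4 → L)) * B 0 +
        linearPoly (t 1 : Module.Dual L (Fin 4 → L)) * B 1 := by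
  have hle : lineIdeal S ≤ Ideal.span {linearPoly (t 0 : Module.Dual L (Fin 4 → L)),
      linearPoly (t 1 : Module.Dual L (Fin 4 → L))} := by
    refine Ideal.span_le.2 ?_
    rintro _ ⟨φ, hφ, rfl⟩
    have h := congrArg (Subtype.val) (t.sum_repr ⟨φ, hφ⟩)
    rw [Submodule.coe_sum] at h
    change ∑ m, t.repr ⟨φ, hφ⟩ m • (t m : Module.Dual L (Fin 4 → L)) = φ at h
    rw [← h, linearPoly_combination, Fin.sum_univ_two]
    exact Ideal.mem_span_pair.2 ⟨_, _, rfl⟩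
  obtain ⟨B0, B1, hB⟩ := Ideal.mem_span_pair.1 (hle hline)
  refine ⟨![MvPolynomial.homogeneousComponent 2 B0, MvPolynomial.homogeneousComponent 2 B1],
    fun m => ?_, ?_⟩
  · fin_cases m
    · exact MvPolynomial.homogeneousComponent_isHomogeneous 2 B0
    · exact MvPolynomial.homogeneousComponent_isHomogeneous 2 B1
  · change F = _ * MvPolynomial.homogeneousComponent 2 B0 +
      _ * MvPolynomial.homogeneousComponent 2 B1
    -- Taking degree-three parts of an arbitrary expression of `F` replaces its cofactors by their
    -- degree-two components.
    rw [← (linearPoly_isHomogeneous _).homogeneousComponent_mul,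
      ← (linearPoly_isHomogeneous _).homogeneousComponent_mul, ← map_add]
    rw [mul_comm _ B0, mul_comm _ B1, hB]
    exact (MvPolynomial.homogeneousComponent_eq_self hF).symm

theorem annihilator_basis_apply_eq_zero (t : Module.Basis (Fin 2) L S.dualAnnihilator)
    {w : Fin 4 → L} (hw : w ∈ S) (m : Fin 2) : (t m : Module.Dual L (Fin 4 → L)) w = 0 :=
  (Submodule.mem_dualAnnihilator _).1 (t m).2 w hw

variable {B : Fin 2 → MvPolynomial (Fin 4) L} {w : Fin 2 → Fin 4 → L}

/-- On a line on a smooth surface the two quadratic coefficients have no common zero. -/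
theorem exists_aeval_restrictTo_ne_zero (hsmooth : IsSmoothSurface F)
    (t : Module.Basis (Fin 2) L S.dualAnnihilator)
    (hB : F = linearPoly (t 0 : Module.Dual L (Fin 4 → L)) * B 0 +
        linearPoly (t 1 : Module.Dual L (Fin 4 → L)) * B 1)
    (hwS : ∀ m, w m ∈ S) (hw : LinearIndependent L w)
    {v : Fin 2 → AlgebraicClosure L} (hv : v ≠ 0) :
    ∃ m, MvPolynomial.aeval v (restrictTo w (B m)) ≠ 0 := by
  by_contra! h
  have ht : ∀ m, MvPolynomial.aeval
      (fun j => ∑ n, algebraMap L (AlgebraicClosure L) (w n j) * v n)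
      (linearPoly (t m : Module.Dual L (Fin 4 → L))) = 0 := fun m =>
    aeval_linearPoly_eq_zero v fun n => annihilator_basis_apply_eq_zero t (hwS n) m
  obtain ⟨j, hj⟩ := hsmooth _ (sum_algebraMap_mul_ne_zero hw hv)
    (by rw [hB, map_add, map_mul, map_mul, ht, ht]; simp only [zero_mul, add_zero])
  simp only [aeval_restrictTo] at h
  refine hj ?_
  rw [hB]
  -- Both factors of each product `tₘ Bₘ` vanish at the point, so by the Leibniz rule every partial
  -- derivative of `F` does too.
  simp only [map_add, Derivation.leibniz, smul_eq_mul, map_mul, ht, h, zero_mul, add_zero]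

/-- The residual projection in homogeneous coordinates. -/
noncomputable def residualPair (hsmooth : IsSmoothSurface F)
    (t : Module.Basis (Fin 2) L S.dualAnnihilator) (hBh : ∀ m, (B m).IsHomogeneous 2)
    (hB : F = linearPoly (t 0 : Module.Dual L (Fin 4 → L)) * B 0 +
        linearPoly (t 1 : Module.Dual L (Fin 4 → L)) * B 1)
    (hwS : ∀ m, w m ∈ S) (hw : LinearIndependent L w) : FormPair L where
  deg := 2
  form := ![restrictTo w (B 1), restrictTo w (-B 0)]
  homog := fun i => by
    fin_cases i
    · exact restrictTo_isHomogeneous w (hBh 1)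
    · exact restrictTo_isHomogeneous w (hBh 0).neg
  basePointFree := fun v hv => by
    obtain ⟨m, hm⟩ := exists_aeval_restrictTo_ne_zero hsmooth t hB hwS hw hv
    fin_cases m
    · refine ⟨1, ?_⟩
      simpa [restrictTo_neg] using hm
    · exact ⟨0, hm⟩

/-- Linear forms whose values at two vectors have nonzero determinant are linearly disjoint modulo
the ideal of a line on which they vanish. -/
theorem restrictTo_eq_zero_of_linearPoly_mul_eq {φ : Fin 2 → Module.Dual L (Fin 4 → L)}
    (hφ : ∀ m n, φ m (w n) = 0) {u : Fin 2 → Fin 4 → L}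
    (hdet : φ 0 (u 0) * φ 1 (u 1) - φ 1 (u 0) * φ 0 (u 1) ≠ 0) {X Y : MvPolynomial (Fin 4) L}
    (h : linearPoly (φ 1) * X = linearPoly (φ 0) * Y) :
    restrictTo w X = 0 ∧ restrictTo w Y = 0 := by
  -- Differentiate the relation along `v` and restrict to the line. Taking `v = u 0` and `v = u 1`
  -- gives a linear system in the two restrictions, solved by Cramer's rule.
  have hu : ∀ v, MvPolynomial.C (φ 1 v) * restrictTo w X =
      MvPolynomial.C (φ 0 v) * restrictTo w Y := fun v => by
    rw [← restrictTo_dirDeriv_linearPoly_mul (hφ 1), ← restrictTo_dirDeriv_linearPoly_mul (hφ 0), h]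
  have hC : (MvPolynomial.C (φ 0 (u 0) * φ 1 (u 1) - φ 1 (u 0) * φ 0 (u 1)) :
      MvPolynomial (Fin 2) L) ≠ 0 := (map_ne_zero_iff _ (MvPolynomial.C_injective _ _)).2 hdet
  simp only [map_sub, map_mul] at hC
  constructor
  · refine (mul_eq_zero.1 ?_).resolve_left hC
    linear_combination MvPolynomial.C (φ 0 (u 0)) * hu (u 1) - MvPolynomial.C (φ 0 (u 1)) * hu (u 0)
  · refine (mul_eq_zero.1 ?_).resolve_left hC
    linear_combination MvPolynomial.C (φ 1 (u 0)) * hu (u 1) - MvPolynomial.C (φ 1 (u 1)) * hu (u 0)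

/-- The residual projection is the only morphism extending the projection from the line. -/
theorem isResidualProjection_iff (hsmooth : IsSmoothSurface F)
    (t : Module.Basis (Fin 2) L S.dualAnnihilator) (hBh : ∀ m, (B m).IsHomogeneous 2)
    (hB : F = linearPoly (t 0 : Module.Dual L (Fin 4 → L)) * B 0 +
        linearPoly (t 1 : Module.Dual L (Fin 4 → L)) * B 1)
    (b : Module.Basis (Fin 2) L S) (hwS : ∀ m, (b m : Fin 4 → L) ∈ S)
    (hw : LinearIndependent L (fun m => (b m : Fin 4 → L))) {u : Fin 2 → Fin 4 → L}
    (hdet : (t 0 : Module.Dual L (Fin 4 → L)) (u 0) * (t 1 : Module.Dual L (Fin 4 → L)) (u 1) -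
      (t 1 : Module.Dual L (Fin 4 → L)) (u 0) * (t 0 : Module.Dual L (Fin 4 → L)) (u 1) ≠ 0)
    (π : P1Map L) :
    IsResidualProjection F b t π ↔ π = (residualPair hsmooth t hBh hB hwS hw).toP1Map := by
  constructor
  · rintro ⟨P, rfl, hP⟩
    refine FormPair.toP1Map_eq_of_cross ?_
    -- One geometric point, here `[1 : 1]`, suffices: a representative that is nonzero there is
    -- nonzero as a pair of forms on the line and so determines `P`.
    obtain ⟨A, ⟨-, hA⟩, ⟨i, hi⟩, hPA⟩ := hP 1 one_ne_zero
    obtain ⟨H, hH⟩ := Ideal.mem_span_singleton.1 hA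
    -- From `t₁ A₀ - t₀ A₁ = F H` follows `t₁ (A₀ - H B₁) = t₀ (A₁ + H B₀)`. Hence on the line `[A₀
    -- : A₁]` is `H` times `[B₁ : -B₀]`, with `H` nonzero there.
    obtain ⟨h0, h1⟩ := restrictTo_eq_zero_of_linearPoly_mul_eq
      (w := fun m => (b m : Fin 4 → L)) (φ := fun m => (t m : Module.Dual L (Fin 4 → L)))
      (fun m n => annihilator_basis_apply_eq_zero t (hwS n) m) hdet
      (X := A 0 - H * B 1) (Y := A 1 + H * B 0) (by rw [hB] at hH; linear_combination hH)
    rw [restrictTo_sub, restrictTo_mul] at h0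
    rw [restrictTo_add, restrictTo_mul] at h1
    have hne : restrictTo (fun m => (b m : Fin 4 → L)) H ≠ 0 := fun h => hi <| by
      rw [h] at h0 h1
      have : ∀ i, restrictTo (fun m => (b m : Fin 4 → L)) (A i) = 0 :=
        Fin.forall_fin_two.2 ⟨by linear_combination h0, by linear_combination h1⟩
      rw [this, map_zero]
    refine mul_left_cancel₀ hne ?_
    change _ * (P.form 0 * restrictTo _ (-B 0)) = _ * (P.form 1 * restrictTo _ (B 1))
    rw [restrictTo_neg]
    linear_combination hPA - P.form 0 * h1 + P.form 1 * h0
  · rintro rfl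
    -- A single representative serves all points of the line.
    refine ⟨_, rfl, fun v hv => ⟨![B 1, -B 0], ⟨⟨2, fun i => ?_⟩, ?_⟩, ?_, mul_comm _ _⟩⟩
    · fin_cases i
      · exact hBh 1
      · exact (hBh 0).neg
    · refine Ideal.mem_span_singleton.2 ⟨1, ?_⟩
      rw [hB]
      simp only [Matrix.cons_val_zero, Matrix.cons_val_one]
      ring
    · obtain ⟨i, hi⟩ := (residualPair hsmooth t hBh hB hwS hw).basePointFree v hv
      refine ⟨i, ?_⟩
      fin_cases i <;> exact hi

theorem annihilator_basis_det_ne_zero (t : Module.Basis (Fin 2) L S.dualAnnihilator)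
    (e : Module.Basis (Fin 4) L (Fin 4 → L)) (h2 : e 2 ∈ S) (h3 : e 3 ∈ S) :
    (Matrix.of fun i m : Fin 2 =>
      (t m : Module.Dual L (Fin 4 → L)) (![e 0, e 1] i)).det ≠ 0 := by
  intro h
  obtain ⟨c, hc, hM⟩ := Matrix.exists_mulVec_eq_zero_iff.2 h
  have h0 := congrFun hM 0
  have h1 := congrFun hM 1
  simp only [Matrix.mulVec, dotProduct, Fin.sum_univ_two, Matrix.of_apply, Matrix.cons_val_zero,
    Matrix.cons_val_one, Pi.zero_apply] at h0 h1
  have a2 := annihilator_basis_apply_eq_zero t h2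
  have a3 := annihilator_basis_apply_eq_zero t h3
  -- A kernel vector gives a functional in `ann(S)` that also kills `e 0` and `e 1`, hence is zero.
  have he : ∀ j, c 0 * (t 0 : Module.Dual L (Fin 4 → L)) (e j) +
      c 1 * (t 1 : Module.Dual L (Fin 4 → L)) (e j) = 0
    | 0 => by linear_combination h0
    | 1 => by linear_combination h1
    | 2 => by rw [a2, a2, mul_zero, mul_zero, add_zero]
    | 3 => by rw [a3, a3, mul_zero, mul_zero, add_zero]
  have hφ : ∑ m, c m • t m = 0 := by
    rw [Fin.sum_univ_two]
    exact Subtype.ext (e.ext he)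
  exact hc (t.eq_zero_of_sum_smul_eq_zero hφ)

/-- Bases of a plane are related by an invertible matrix. -/
theorem exists_det_ne_zero_of_span (b : Module.Basis (Fin 2) L S)
    (hS : S = Submodule.span L {w 0, w 1}) :
    ∃ N : Matrix (Fin 2) (Fin 2) L, N.det ≠ 0 ∧
      ∀ m, (b m : Fin 4 → L) = ∑ n, N m n • w n := by
  have h : ∀ m, ∃ x y : L, x • w 0 + y • w 1 = b m := fun m =>
    Submodule.mem_span_pair.1 (hS ▸ (b m).2)
  choose x y hxy using h
  refine ⟨Matrix.of fun m => ![x m, y m], fun hdet => ?_, fun m => ?_⟩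
  -- A left kernel vector would be a linear relation between `b 0` and `b 1`.
  · obtain ⟨c, hc, hM⟩ := Matrix.exists_vecMul_eq_zero_iff.2 hdet
    suffices hsum : ∑ m, c m • b m = 0 from
      hc (b.eq_zero_of_sum_smul_eq_zero hsum)
    refine Subtype.ext ?_
    have h0 := congrFun hM 0
    have h1 := congrFun hM 1
    simp only [Matrix.vecMul, dotProduct, Fin.sum_univ_two, Matrix.of_apply, Matrix.cons_val_zero,
      Matrix.cons_val_one, Pi.zero_apply] at h0 h1
    rw [Fin.sum_univ_two]
    change c 0 • (b 0 : Fin 4 → L) + c 1 • (b 1 : Fin 4 → L) = 0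
    rw [← hxy, ← hxy]
    calc _ = (c 0 * x 0 + c 1 * x 1) • w 0 + (c 0 * y 0 + c 1 * y 1) • w 1 := by module
      _ = 0 := by rw [h0, h1, zero_smul, zero_smul, add_zero]
  · rw [← hxy, Fin.sum_univ_two]
    rfl

end ResidualProjection

/-! ### The main theorem: comparison of resultants modulo squares -/

theorem mainTheorem5 {k : Type v} {L : Type u} [Field k] [Field L] [Algebra k L]
    [FiniteDimensional k L] (h2 : (2 : k) ≠ 0)
    (f : MvPolynomial (Fin 4) k) (hf : f.IsHomogeneous 3) (hsmooth : IsSmoothSurface f)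
    (S : Submodule L (Fin 4 → L)) (e : Module.Basis (Fin 4) L (Fin 4 → L))
    (hS : S = Submodule.span L {e 2, e 3})
    (hline : MvPolynomial.map (algebraMap k L) f ∈ lineIdeal S)
    (b : Module.Basis (Fin 2) L S) (t : Module.Basis (Fin 2) L S.dualAnnihilator) :
    (∃! π : P1Map L, IsResidualProjection (MvPolynomial.map (algebraMap k L) f) b t π) ∧
    (∃! i : (P1Map L)ˣ, IsAssociatedInvolution (MvPolynomial.map (algebraMap k L) f) b t i) ∧
    ∃ hRes : quadraticResultant
        (restrictTo ![e 2, e 3] (dirDeriv (e 0) (MvPolynomial.map (algebraMap k L) f)))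
        (restrictTo ![e 2, e 3] (dirDeriv (e 1) (MvPolynomial.map (algebraMap k L) f))) ≠ 0,
      ∀ i : (P1Map L)ˣ,
        IsAssociatedInvolution (MvPolynomial.map (algebraMap k L) f) b t i →
        GW.unitCls (-1) * P1Map.a1Degree (i : P1Map L) = GW.unitCls (Units.mk0 _ hRes) := by
  have hL2 : (2 : L) ≠ 0 := by
    rw [← map_ofNat (algebraMap k L) 2]
    exact (map_ne_zero_iff _ (algebraMap k L).injective).2 h2
  have hF : (MvPolynomial.map (algebraMap k L) f).IsHomogeneous 3 := hf.map _
  have hsm : IsSmoothSurface (MvPolynomial.map (algebraMap k L) f) := hsmooth.map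
  -- From here on the argument takes place over `L` alone.
  generalize MvPolynomial.map (algebraMap k L) f = F at *
  have he2 : e 2 ∈ S := hS ▸ Submodule.subset_span (Set.mem_insert _ _)
  have he3 : e 3 ∈ S := hS ▸ Submodule.subset_span (Set.mem_insert_of_mem _ rfl)
  have hwS : ∀ m, (b m : Fin 4 → L) ∈ S := fun m => (b m).2
  have hw : LinearIndependent L (fun m => (b m : Fin 4 → L)) :=
    b.linearIndependent.map' S.subtype S.ker_subtype
  obtain ⟨B, hBh, hB⟩ := exists_eq_linearPoly_mul_add hF hline t
  set M : Matrix (Fin 2) (Fin 2) L := Matrix.of fun i m : Fin 2 =>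
    (t m : Module.Dual L (Fin 4 → L)) (![e 0, e 1] i)
  have hM : M.det ≠ 0 := annihilator_basis_det_ne_zero t e he2 he3
  obtain ⟨N, hN, hbN⟩ := exists_det_ne_zero_of_span (w := ![e 2, e 3]) b hS
  have hdet : (t 0 : Module.Dual L (Fin 4 → L)) (![e 0, e 1] 0) *
      (t 1 : Module.Dual L (Fin 4 → L)) (![e 0, e 1] 1) -
      (t 1 : Module.Dual L (Fin 4 → L)) (![e 0, e 1] 0) *
      (t 0 : Module.Dual L (Fin 4 → L)) (![e 0, e 1] 1) ≠ 0 := by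
    rw [Matrix.det_fin_two] at hM
    exact hM
  have hproj := isResidualProjection_iff hsm t hBh hB b hwS hw hdet
  set P := residualPair hsm t hBh hB hwS hw
  have hresP := P.resultant_ne_zero rfl
  obtain ⟨i, hi, huniq, hdeg⟩ := P.exists_unique_involution hL2 rfl hresP
  have hinv : ∀ j, IsAssociatedInvolution F b t j ↔ j ∈ galoisGroup P.toP1Map ∧ j ≠ 1 :=
    fun j => ⟨fun ⟨π, hπ, hj⟩ => (hproj π).1 hπ ▸ hj, fun hj => ⟨_, (hproj _).2 rfl, hj⟩⟩
  -- In `∂(tₘ Bₘ)` only the term with `tₘ` differentiated survives on the line.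
  have hq : ∀ i, restrictTo ![e 2, e 3] (dirDeriv (![e 0, e 1] i) F) =
      ∑ m, MvPolynomial.C (M i m) * restrictTo ![e 2, e 3] (B m) := fun i => by
    have ht : ∀ m n, (t m : Module.Dual L (Fin 4 → L)) (![e 2, e 3] n) = 0 := fun m n =>
      annihilator_basis_apply_eq_zero t (by fin_cases n; exacts [he2, he3]) m
    rw [hB, dirDeriv_add, restrictTo_add, restrictTo_dirDeriv_linearPoly_mul (ht 0),
      restrictTo_dirDeriv_linearPoly_mul (ht 1), Fin.sum_univ_two]
    rfl
  have hBr : ∀ m, (restrictTo ![e 2, e 3] (B m)).IsHomogeneous 2 := fun m =>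
    restrictTo_isHomogeneous _ (hBh m)
  have hq0 : quadraticResultant (restrictTo ![e 2, e 3] (dirDeriv (e 0) F))
      (restrictTo ![e 2, e 3] (dirDeriv (e 1) F)) =
      quadraticResultant (restrictTo ![e 2, e 3] (B 0)) (restrictTo ![e 2, e 3] (B 1)) *
        M.det ^ 2 := by
    rw [← quadraticResultant_combination hBr M, ← hq, ← hq]
    rfl
  have hq1 : quadraticResultant (P.form 0) (P.form 1) =
      quadraticResultant (restrictTo ![e 2, e 3] (B 0)) (restrictTo ![e 2, e 3] (B 1)) *
        (N.det ^ 2) ^ 2 := by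
    -- Passing from `(B₀, B₁)` to `(B₁, -B₀)` has determinant 1, so it does not change the
    -- resultant.
    have hrot := quadraticResultant_combination (p := fun m => restrictTo (fun m => b m) (B m))
      (fun m => restrictTo_isHomogeneous _ (hBh m)) !![0, 1; -1, 0]
    simp only [Fin.sum_univ_two, Matrix.det_fin_two, Matrix.of_apply, Matrix.cons_val_zero,
      Matrix.cons_val_one, map_zero, map_one, map_neg, zero_mul, one_mul, zero_add, add_zero,
      zero_sub, mul_zero, neg_mul, neg_neg, one_pow, mul_one] at hrot
    change quadraticResultant (restrictTo (fun m => b m) (B 1)) (restrictTo _ (-B 0)) = _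
    rw [restrictTo_neg, hrot, restrictTo_change _ _ N hbN, restrictTo_change _ _ N hbN,
      quadraticResultant_substitution hBr N]
  have hres := hresP
  rw [hq1] at hres
  have hR0 := left_ne_zero_of_mul hres
  have hRes : quadraticResultant (restrictTo ![e 2, e 3] (dirDeriv (e 0) F))
      (restrictTo ![e 2, e 3] (dirDeriv (e 1) F)) ≠ 0 := by
    rw [hq0]
    exact mul_ne_zero hR0 (pow_ne_zero 2 hM)
  refine ⟨⟨P.toP1Map, (hproj _).2 rfl, fun π hπ => (hproj π).1 hπ⟩,
    ⟨i, (hinv i).2 hi, fun j hj => huniq j ((hinv j).1 hj)⟩, hRes, fun j hj => ?_⟩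
  -- Both resultants are that of `B₀`, `B₁` in the coordinates dual to `e 2`, `e 3`, times a nonzero
  -- square.
  rw [huniq j ((hinv j).1 hj), hdeg,
    show Units.mk0 _ hRes = Units.mk0 _ hR0 * Units.mk0 _ hM ^ 2 from Units.ext hq0,
    show Units.mk0 _ hresP = Units.mk0 _ hR0 * (Units.mk0 _ hN ^ 2) ^ 2 from Units.ext hq1,
    GW.unitCls_mul_sq, GW.unitCls_mul_sq]
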